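/- **Conventions.** For integers $a\ge 0$ and $d\ge 1$ write $a$ uniquely as $a=\binom{a_d}{d}+\binom{a_{d-1}}{d-1}+\cdots+\binom{a_\delta}{\delta}$ with $a_d>a_{d-1}>\cdots>a_\delta\ge\delta\ge 1$ (the $d$-th Macaulay representation; the sum is empty if $a=0$), and put $a_{\langle d\rangle}=\binom{a_d-1}{d}+\binom{a_{d-1}-1}{d-1}+\cdots+\binom{a_\delta-1}{\delta}$, where $\binom{c}{e}=0$ for $0\le c<e$. For $d=0$ put $a_{\langle 0\rangle}=a$, and put $0_{\langle d\rangle}=0$ for $d<0$. Let $k$ be an infinite field, $S=k[x_1,\dots,x_n]$ with the standard grading, and $F=Se_1\oplus\cdots\oplus Se_r$ a graded free module with $\deg e_i=f_i\in\mathbb Z$ and $f_1\le f_2\le\cdots\le f_r$. Write $F_m$ for the component of degree $m$ and $H(N,m)=\dim_k N_m$ for the Hilbert function of a graded module $N$. For a graded submodule $M\subseteq F$ and a linear form $\ell\in S_1$ let $(F/M)_\ell=F/(M+\ell F)$. A property holds for a generic linear form if it holds for all $\ell$ in some nonempty Zariski open subset of $S_1\cong k^n$. Order the monomials $ue_i$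 of $F$ ($u$ a monomial of $S$) of a given degree $m$ by: $ue_i>ve_j$ if $i<j$, or $i=j$ and $u>_{lex}v$, where $x_1>\cdots>x_n$. A lex-segment of length $p$ in $F_m$ is the set of the $p$ largest monomials of $F_m$. For $m\in\mathbb Z$ put $d_i=m-f_i$ and $N_i=\dim_k S_{d_i}$, which is $\binom{n+d_i-1}{d_i}$ if $d_i\ge 0$ (with $\binom{-1}{0}=1$) and $0$ if $d_i<0$. For $r\ge 1$ and $0\le a\le\sum_{i=1}^r N_i$ choose $j\in\{1,\dots,r\}$ with $\sum_{i=j+1}^r N_i\le a\le\sum_{i=j}^r N_i$ and define $$a_{\{m,r\}}=\Bigl(a-\sum_{i=j+1}^r N_i\Bigr)_{\langle d_j\rangle}+\sum_{i=j+1}^r (N_i)_{\langle d_i\rangle};$$ this does not depend on the choice of $j$. If $r=0$, put $0_{\{m,0\}}=0$. **Theorem.** Let $M\subseteq F$ be a graded submodule. For every degree $m$ there is a graded submodule $L\subseteq F$ whose component $L_m$ is the $k$-span of the lex-segment of length $H(M,m)$ in $F_m$. For a generic linear form $\ell$ the following holds for every degree $m$ and every such $L$: $$H((F/M)_\ell,m)\le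 H((F/L)_\ell,m)\qquad\text{and}\qquad H((F/L)_\ell,m)=H(F/M,m)_{\{m,r\}}.$$ -/

import Mathlib

namespace GreenModule

/-! ### Macaulay representations -/

/-- `a = C(c d, d) + C(c (d-1), d-1) + ⋯ + C(c δ, δ)` with `c d > ⋯ > c δ ≥ δ ≥ 1`; the number `0`
has the empty representation, `δ = d + 1`. -/
structure IsMacaulayRep (d a : ℕ) (c : ℕ → ℕ) (δ : ℕ) : Prop where
  one_le : 1 ≤ δ
  le_succ : δ ≤ d + 1
  lt_of_lt : ∀ i j, δ ≤ i → i < j → j ≤ d → c i < c j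
  le_coeff : ∀ i, δ ≤ i → i ≤ d → i ≤ c i
  sum_eq : a = ∑ i ∈ Finset.Icc δ d, (c i).choose i

/-- The largest `c` with `C(c, d) ≤ a` (for `d ≥ 1`). -/
def topCoeff (d a : ℕ) : ℕ := Nat.findGreatest (fun c => c.choose d ≤ a) (a + d)

/-- The number `a_⟨d⟩ = C(a_d - 1, d) + ⋯ + C(a_δ - 1, δ)`, where
`a = C(a_d, d) + ⋯ + C(a_δ, δ)` is the `d`-th Macaulay representation, computed greedily;
see `macaulayLower_eq`.  In degree `0` the convention is `a_⟨0⟩ = a`. -/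
def macaulayLower : ℕ → ℕ → ℕ
  | 0, a => a
  | d + 1, a =>
    (topCoeff (d + 1) a - 1).choose (d + 1)
      + macaulayLower d (a - (topCoeff (d + 1) a).choose (d + 1))

theorem choose_lt_of_lt {d x y : ℕ} (hy : d + 1 ≤ y) (h : x < y) :
    x.choose (d + 1) < y.choose (d + 1) := by
  obtain ⟨y, rfl⟩ : ∃ z, y = z + 1 := ⟨y - 1, by omega⟩
  have h1 : x.choose (d + 1) ≤ y.choose (d + 1) := Nat.choose_le_choose _ (by omega)
  have h2 : 0 < y.choose d := Nat.choose_pos (by omega)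
  have h3 := Nat.choose_succ_succ y d
  simp only [Nat.succ_eq_add_one] at h3
  omega

theorem add_lt_choose (d a : ℕ) : a < (a + d + 1).choose (d + 1) := by
  induction a with
  | zero => simp
  | succ a ih =>
    have := choose_lt_of_lt (d := d) (x := a + d + 1) (y := a + 1 + d + 1) (by omega) (by omega)
    omega

theorem topCoeff_eq {d a c : ℕ} (h1 : c.choose (d + 1) ≤ a) (h2 : a < (c + 1).choose (d + 1)) :
    topCoeff (d + 1) a = c := by
  have hlt : ∀ x, x.choose (d + 1) ≤ a → x ≤ c := by
    intro x hx
    by_contra hcx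
    have := Nat.choose_le_choose (d + 1) (show c + 1 ≤ x by omega)
    omega
  have hc : c ≤ a + (d + 1) := by
    by_contra hh
    have := Nat.choose_le_choose (d + 1) (show a + d + 1 ≤ c by omega)
    have := add_lt_choose d a
    omega
  apply le_antisymm
  · exact hlt _ (Nat.findGreatest_spec (P := fun c => c.choose (d + 1) ≤ a) hc h1)
  · exact Nat.le_findGreatest hc h1

theorem topCoeff_spec (d a : ℕ) : (topCoeff (d + 1) a).choose (d + 1) ≤ a ∧
    a < (topCoeff (d + 1) a + 1).choose (d + 1) := by
  refine ⟨Nat.findGreatest_spec (P := fun c => c.choose (d + 1) ≤ a) (m := 0) (by omega)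
    (by simp), ?_⟩
  by_contra hh
  push Not at hh
  have hle : topCoeff (d + 1) a + 1 ≤ a + (d + 1) := by
    by_contra h2
    have := Nat.choose_le_choose (d + 1) (show a + d + 1 ≤ topCoeff (d + 1) a + 1 by omega)
    have := add_lt_choose d a
    omega
  have : topCoeff (d + 1) a + 1 ≤ topCoeff (d + 1) a :=
    Nat.le_findGreatest (P := fun c => c.choose (d + 1) ≤ a) hle hh
  omega

theorem macaulayLower_zero (d : ℕ) : macaulayLower d 0 = 0 := by
  induction d with
  | zero => rfl
  | succ d ih =>
    have h : topCoeff (d + 1) 0 = d := topCoeff_eq (by simp) (by simp)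
    simp [macaulayLower, h, ih, Nat.choose_eq_zero_of_lt (show d - 1 < d + 1 by omega)]

/-- A number with a `d`-th Macaulay representation of leading coefficient `c d` is smaller than
`C(c d + 1, d)`. -/
theorem IsMacaulayRep.lt {d a δ : ℕ} {c : ℕ → ℕ} (h : IsMacaulayRep d a c δ) (hδ : δ ≤ d) :
    a < (c d + 1).choose d := by
  induction d generalizing a with
  | zero => have := h.one_le; omega
  | succ d ih =>
    have hs := h.sum_eq
    rw [Finset.sum_Icc_succ_top hδ] at hs
    have hp := Nat.choose_succ_succ (c (d + 1)) d
    simp only [Nat.succ_eq_add_one] at hp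
    have hcd := h.le_coeff (d + 1) hδ le_rfl
    rcases Nat.lt_or_ge d δ with hlt | hle
    · rw [Finset.Icc_eq_empty (by omega), Finset.sum_empty] at hs
      have : 0 < (c (d + 1)).choose d := Nat.choose_pos (by omega)
      omega
    · have h' : IsMacaulayRep d (∑ i ∈ Finset.Icc δ d, (c i).choose i) c δ :=
        ⟨h.one_le, by omega, fun i j h1 h2 h3 => h.lt_of_lt i j h1 h2 (by omega),
          fun i h1 h2 => h.le_coeff i h1 (by omega), rfl⟩
      have h1 := ih h' hle
      have h2 := Nat.choose_le_choose d (h.lt_of_lt d (d + 1) hle (by omega) le_rfl)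
      simp only [Nat.succ_eq_add_one] at h2
      omega

/-- `macaulayLower` is computed by every Macaulay representation. -/
theorem macaulayLower_eq {d a δ : ℕ} {c : ℕ → ℕ} (h : IsMacaulayRep d a c δ) :
    macaulayLower d a = ∑ i ∈ Finset.Icc δ d, (c i - 1).choose i := by
  induction d generalizing a with
  | zero =>
    have h1 := h.one_le
    have hs := h.sum_eq
    rw [Finset.Icc_eq_empty (by omega), Finset.sum_empty] at hs
    rw [Finset.Icc_eq_empty (by omega), Finset.sum_empty, hs]
    rfl
  | succ d ih =>
    have hs := h.sum_eq
    rcases Nat.lt_or_ge (d + 1) δ with hlt | hδ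
    · rw [Finset.Icc_eq_empty (by omega), Finset.sum_empty] at hs
      rw [Finset.Icc_eq_empty (by omega), Finset.sum_empty, hs, macaulayLower_zero]
    · have hl := h.lt hδ
      rw [Finset.sum_Icc_succ_top hδ] at hs
      have ht : topCoeff (d + 1) a = c (d + 1) := topCoeff_eq (by omega) hl
      have h' : IsMacaulayRep d (a - (c (d + 1)).choose (d + 1)) c δ :=
        ⟨h.one_le, by omega, fun i j h1 h2 h3 => h.lt_of_lt i j h1 h2 (by omega),
          fun i h1 h2 => h.le_coeff i h1 (by omega), by omega⟩
      rw [macaulayLower, ht, ih h', Finset.sum_Icc_succ_top hδ, add_comm]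

/-- For `d ≥ 1` every natural number has a `d`-th Macaulay representation. -/
theorem exists_isMacaulayRep (d a : ℕ) :
    ∃ c δ, IsMacaulayRep (d + 1) a c δ := by
  induction d generalizing a with
  | zero =>
    rcases Nat.eq_zero_or_pos a with rfl | ha
    · exact ⟨id, 2, by omega, by omega, fun i j => by omega, fun i => by omega, by simp⟩
    · exact ⟨fun _ => a, 1, by omega, by omega, fun i j => by omega, fun i => by omega, by simp⟩
  | succ d ih =>
    rcases Nat.eq_zero_or_pos a with rfl | ha
    · exact ⟨id, d + 3, by omega, by omega, fun i j => by omega, fun i => by omega, by simp⟩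
    obtain ⟨h1, h2⟩ := topCoeff_spec (d + 1) a
    set t := topCoeff (d + 1 + 1) a with ht
    have htd : d + 2 ≤ t := by
      by_contra hh
      have := Nat.choose_le_choose (d + 1 + 1) (show t + 1 ≤ d + 2 by omega)
      simp at this
      omega
    obtain ⟨c, δ, hc⟩ := ih (a - t.choose (d + 1 + 1))
    have hp := Nat.choose_succ_succ t (d + 1)
    simp only [Nat.succ_eq_add_one] at hp
    have hct : δ ≤ d + 1 → c (d + 1) < t := by
      intro hδ
      by_contra hh
      have h3 := hc.sum_eq
      rw [Finset.sum_Icc_succ_top hδ] at h3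
      have := Nat.choose_le_choose (d + 1) (show t ≤ c (d + 1) by omega)
      omega
    have hne : ∀ i, i ≤ d + 1 → Function.update c (d + 2) t i = c i := fun i hi =>
      Function.update_of_ne (by omega) _ _
    refine ⟨Function.update c (d + 2) t, δ, hc.one_le, ?_, ?_, ?_, ?_⟩
    · have := hc.le_succ; omega
    · intro i j hi hij hj
      rw [hne i (by omega)]
      rcases Nat.lt_or_ge j (d + 2) with hj' | hj'
      · rw [hne j (by omega)]
        exact hc.lt_of_lt i j hi hij (by omega)
      · obtain rfl : j = d + 2 := by omega
        rw [Function.update_self]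
        have hlt := hct (by omega)
        rcases Nat.lt_or_ge i (d + 1) with hi' | hi'
        · exact (hc.lt_of_lt i (d + 1) hi hi' le_rfl).trans hlt
        · obtain rfl : i = d + 1 := by omega
          exact hlt
    · intro i hi hid
      rcases Nat.lt_or_ge i (d + 2) with hi' | hi'
      · rw [hne i (by omega)]
        exact hc.le_coeff i hi (by omega)
      · obtain rfl : i = d + 2 := by omega
        rwa [Function.update_self]
    · rw [Finset.sum_Icc_succ_top (by have := hc.le_succ; omega)]
      rw [Finset.sum_congr rfl (g := fun i => (c i).choose i)
        (fun i hi => by rw [hne i (Finset.mem_Icc.mp hi).2])]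
      rw [← hc.sum_eq, Function.update_self]
      omega

/-! ### The numerical bound `a_{m,r}` -/

/-- `dim_k S_d` for `S = k[x_1, …, x_n]`: it is `C(n + d - 1, d)` for `d ≥ 0`, and `0` for `d < 0`. -/
def polyDim (n : ℕ) (d : ℤ) : ℕ :=
  if 0 ≤ d then (n + d.toNat - 1).choose d.toNat else 0

/-- `N_{j+1} + ⋯ + N_r ≤ a ≤ N_j + ⋯ + N_r`, where `N_i = dim_k S_{m - f_i}`. -/
def IsSplitIndex (n : ℕ) {r : ℕ} (f : Fin r → ℤ) (m : ℤ) (a : ℕ) (j : Fin r) : Prop :=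
  ∑ i ∈ Finset.Ioi j, polyDim n (m - f i) ≤ a ∧ a ≤ ∑ i ∈ Finset.Ici j, polyDim n (m - f i)

/-- `(a - (N_{j+1} + ⋯ + N_r))_⟨d_j⟩ + (N_{j+1})_⟨d_{j+1}⟩ + ⋯ + (N_r)_⟨d_r⟩`, `d_i = m - f_i`.
Where `d_i < 0`, the term is `0_⟨0⟩ = 0`. -/
def splitValue (n : ℕ) {r : ℕ} (f : Fin r → ℤ) (m : ℤ) (a : ℕ) (j : Fin r) : ℕ :=
  macaulayLower (m - f j).toNat (a - ∑ i ∈ Finset.Ioi j, polyDim n (m - f i))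
    + ∑ i ∈ Finset.Ioi j, macaulayLower (m - f i).toNat (polyDim n (m - f i))

open Classical in
/-- The number `a_{m,r}`: the value `splitValue n f m a j` for any `j` such that
`N_{j+1} + ⋯ + N_r ≤ a ≤ N_j + ⋯ + N_r`. -/
noncomputable def moduleLower (n : ℕ) {r : ℕ} (f : Fin r → ℤ) (m : ℤ) (a : ℕ) : ℕ :=
  if h : ∃ j, IsSplitIndex n f m a j then splitValue n f m a h.choose else 0

theorem splitValue_eq (n : ℕ) {r : ℕ} (f : Fin r → ℤ) (m : ℤ) (a : ℕ) (j : Fin r)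
    (h : IsSplitIndex n f m a j) :
    splitValue n f m a j = ∑ i, macaulayLower (m - f i).toNat
      (min (polyDim n (m - f i)) (a - ∑ l ∈ Finset.Ioi i, polyDim n (m - f l))) := by
  obtain ⟨h1, h2⟩ := h
  have hIci : ∀ i : Fin r, ∑ l ∈ Finset.Ici i, polyDim n (m - f l)
      = polyDim n (m - f i) + ∑ l ∈ Finset.Ioi i, polyDim n (m - f l) := by
    intro i
    rw [← Finset.Ioi_insert, Finset.sum_insert (by simp)]
  have hz : ∑ i ∈ Finset.Iio j, macaulayLower (m - f i).toNat
      (min (polyDim n (m - f i)) (a - ∑ l ∈ Finset.Ioi i, polyDim n (m - f l))) = 0 := by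
    apply Finset.sum_eq_zero
    intro i hi
    have hsub : Finset.Ici j ⊆ Finset.Ioi i := by
      intro l hl
      simp only [Finset.mem_Ici, Finset.mem_Ioi, Finset.mem_Iio] at *
      exact lt_of_lt_of_le hi hl
    have := Finset.sum_le_sum_of_subset (f := fun l => polyDim n (m - f l)) hsub
    rw [show a - ∑ l ∈ Finset.Ioi i, polyDim n (m - f l) = 0 by omega, Nat.min_zero,
      macaulayLower_zero]
  have hu : (Finset.univ : Finset (Fin r)) = Finset.Iio j ∪ insert j (Finset.Ioi j) := by
    ext i
    simp only [Finset.mem_univ, Finset.mem_union, Finset.mem_Iio, Finset.mem_insert,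
      Finset.mem_Ioi, true_iff]
    rcases lt_trichotomy i j with h | h | h <;> simp [h]
  have hd : Disjoint (Finset.Iio j) (insert j (Finset.Ioi j)) := by
    rw [Finset.disjoint_left]
    intro i hi hi'
    simp only [Finset.mem_Iio, Finset.mem_insert, Finset.mem_Ioi] at hi hi'
    rcases hi' with rfl | h
    · exact lt_irrefl _ hi
    · exact lt_irrefl _ (hi.trans h)
  rw [hu, Finset.sum_union hd, hz, zero_add, Finset.sum_insert (by simp), splitValue]
  have hj := hIci j
  congr 1
  · rw [Nat.min_eq_right (by omega)]
  · apply Finset.sum_congr rfl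
    intro i hi
    have hsub : Finset.Ici i ⊆ Finset.Ioi j := by
      intro l hl
      simp only [Finset.mem_Ici, Finset.mem_Ioi] at *
      exact lt_of_lt_of_le hi hl
    have := Finset.sum_le_sum_of_subset (f := fun l => polyDim n (m - f l)) hsub
    have := hIci i
    rw [Nat.min_eq_left (by omega)]

/-- `moduleLower` does not depend on the choice of `j`. -/
theorem moduleLower_eq (n : ℕ) {r : ℕ} (f : Fin r → ℤ) (m : ℤ) (a : ℕ) (j : Fin r)
    (h : IsSplitIndex n f m a j) : moduleLower n f m a = splitValue n f m a j := by
  have he : ∃ j, IsSplitIndex n f m a j := ⟨j, h⟩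
  rw [moduleLower, dif_pos he, splitValue_eq n f m a _ he.choose_spec, splitValue_eq n f m a j h]

/-- An index `j` as in the definition of `moduleLower` exists for all `a ≤ N_1 + ⋯ + N_r`. -/
theorem exists_isSplitIndex (n : ℕ) {r : ℕ} (hr : 0 < r) (f : Fin r → ℤ) (m : ℤ) (a : ℕ)
    (ha : a ≤ ∑ i, polyDim n (m - f i)) : ∃ j, IsSplitIndex n f m a j := by
  classical
  let T := Finset.univ.filter fun j : Fin r => a ≤ ∑ i ∈ Finset.Ici j, polyDim n (m - f i)
  have hT : T.Nonempty := by
    refine ⟨⟨0, hr⟩, ?_⟩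
    have : Finset.Ici (⟨0, hr⟩ : Fin r) = Finset.univ := by
      ext i
      simp [Fin.le_def]
    simp only [T, Finset.mem_filter, Finset.mem_univ, true_and, this]
    exact ha
  refine ⟨T.max' hT, ?_, (Finset.mem_filter.mp (T.max'_mem hT)).2⟩
  set j := T.max' hT with hj
  by_cases hlast : (j : ℕ) + 1 < r
  · have hI : Finset.Ioi j = Finset.Ici (⟨j + 1, hlast⟩ : Fin r) := by
      ext i
      simp only [Finset.mem_Ioi, Finset.mem_Ici, Fin.lt_def, Fin.le_def]
      omega
    rw [hI]
    by_contra hh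
    have hmem : (⟨j + 1, hlast⟩ : Fin r) ∈ T := by
      simp only [T, Finset.mem_filter, Finset.mem_univ, true_and]
      omega
    have := T.le_max' _ hmem
    rw [← hj, Fin.le_def] at this
    simp at this
  · have hI : Finset.Ioi j = ∅ := by
      ext i
      simp only [Finset.mem_Ioi, Fin.lt_def, Finset.notMem_empty, iff_false]
      omega
    rw [hI]
    simp

/-! ### Graded submodules of a graded free module and Hilbert functions -/

/-- The polynomial ring `S = k[x_1, …, x_n]`. -/
abbrev Poly (k : Type*) [Field k] (n : ℕ) : Type _ := MvPolynomial (Fin n) k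

/-- The free module `F = S e_1 ⊕ ⋯ ⊕ S e_r`. -/
abbrev FreeMod (k : Type*) [Field k] (n r : ℕ) : Type _ := Fin r → Poly k n

section

variable {k : Type*} [Field k] {n r : ℕ}

/-- The degree of the monomial `x^a e_i`, written as the pair `(i, a)`, when `deg e_i = f i`. -/
noncomputable def monDegree (f : Fin r → ℤ) (u : Fin r × (Fin n →₀ ℕ)) : ℤ := (u.2.degree : ℤ) + f u.1

/-- The homogeneous component `F_m`: all monomials `x^a e_i` that occur have degree `m`. -/
noncomputable def piece (k : Type*) [Field k] (n : ℕ) {r : ℕ} (f : Fin r → ℤ) (m : ℤ) :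
    Submodule k (FreeMod k n r) where
  carrier := {v | ∀ i, ∀ a ∈ (v i).support, monDegree f (i, a) = m}
  zero_mem' := by simp
  add_mem' := by
    classical
    intro v w hv hw i a ha
    rcases Finset.mem_union.mp (MvPolynomial.support_add ha) with h | h
    · exact hv i a h
    · exact hw i a h
  smul_mem' := by
    intro c v hv i a ha
    exact hv i a (MvPolynomial.support_smul ha)

/-- `M_m = M ∩ F_m`. -/
noncomputable def subPiece (f : Fin r → ℤ) (M : Submodule (Poly k n) (FreeMod k n r)) (m : ℤ) :
    Submodule k (FreeMod k n r) :=
  M.restrictScalars k ⊓ piece k n f m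

/-- `M` is a graded submodule of `F`: it is the sum of its homogeneous components. -/
def IsGraded (f : Fin r → ℤ) (M : Submodule (Poly k n) (FreeMod k n r)) : Prop :=
  ⨆ m, subPiece f M m = M.restrictScalars k

/-- `H(M, m) = dim_k M_m`. -/
noncomputable def hilb (f : Fin r → ℤ) (M : Submodule (Poly k n) (FreeMod k n r)) (m : ℤ) : ℕ :=
  Module.finrank k (subPiece f M m)

/-- `H(F/M, m) = dim_k (F/M)_m`, where `(F/M)_m` is the image of `F_m` in `F/M`. -/
noncomputable def hilbQuot (f : Fin r → ℤ) (M : Submodule (Poly k n) (FreeMod k n r)) (m : ℤ) :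
    ℕ :=
  Module.finrank k ((piece k n f m).map (M.mkQ.restrictScalars k))

/-- `M + ℓF`, so that `(F/M)_ℓ = F/(M + ℓF)`. -/
noncomputable def addForm (M : Submodule (Poly k n) (FreeMod k n r)) (l : Poly k n) :
    Submodule (Poly k n) (FreeMod k n r) :=
  M ⊔ Ideal.span {l} • ⊤

/-! ### Lex-segments -/

/-- `u >_lex v` for monomials `u = x^a e_i` and `v = x^b e_j` of `F`: either `i < j`, or `i = j` and
`x^a >_lex x^b`, where `x_1 > ⋯ > x_n`. -/
def MonGT (u v : Fin r × (Fin n →₀ ℕ)) : Prop :=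
  u.1 < v.1 ∨ u.1 = v.1 ∧ toLex v.2 < toLex u.2

/-- `A` is a lex-segment of monomials of degree `m` in `F`: with a monomial it contains every
lexicographically larger one of degree `m`. -/
def IsLexSegment (f : Fin r → ℤ) (m : ℤ) (A : Finset (Fin r × (Fin n →₀ ℕ))) : Prop :=
  (∀ u ∈ A, monDegree f u = m) ∧ ∀ u ∈ A, ∀ v, monDegree f v = m → MonGT v u → v ∈ A

/-- `L` is a graded submodule whose component `L_m` is the `k`-span of a lex-segment of `p`
monomials. -/
def IsLexInDegree (f : Fin r → ℤ) (L : Submodule (Poly k n) (FreeMod k n r)) (m : ℤ) (p : ℕ) :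
    Prop :=
  IsGraded f L ∧ ∃ A : Finset (Fin r × (Fin n →₀ ℕ)), IsLexSegment f m A ∧ A.card = p ∧
    subPiece f L m = Submodule.span k
      ((fun u : Fin r × (Fin n →₀ ℕ) =>
        (Pi.single u.1 (MvPolynomial.monomial u.2 1) : FreeMod k n r)) '' A)

/-! ### Generic linear forms -/

/-- The linear form `c_1 x_1 + ⋯ + c_n x_n`. -/
noncomputable def linForm (c : Fin n → k) : Poly k n :=
  ∑ i, MvPolynomial.C (c i) * MvPolynomial.X i

/-- `P` holds for a generic linear form: it holds on a nonempty Zariski open subset of `S_1 = kⁿ`. -/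
def ForGenericForm (P : Poly k n → Prop) : Prop :=
  ∃ U : Set (Fin n → k), U.Nonempty ∧
    (∃ I : Ideal (MvPolynomial (Fin n) k), U = (MvPolynomial.zeroLocus k I)ᶜ) ∧
    ∀ c ∈ U, P (linForm c)

end

end GreenModule

namespace GreenModule

/-! ### Numerical properties of `a_⟨d⟩` -/

/-! Write `a⟨d⟩` for `macaulayLower d a`. The inequality is proved by Green's argument. Fix a degree
`m`, let `ℓ` be generic, and put `a = dim (F/M)_m` and `c = dim (F/(M + ℓF))_m`. Multiplication by
`ℓ` gives the exact sequence `0 → (F/(M : ℓ))(-1) → F/M → F/(M + ℓF) → 0`, so `a - c = dim (F/(M :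
ℓ))_{m-1}` (`codim_eq`). For a second form `ℓ'`, minimality of `c` among all linear forms and the
same sequence taken modulo `ℓ'` give `c ≤ dim (F/((M : ℓ) + ℓ'F))_{m-1} + dim (F/(M + ℓF + ℓ'F))_m`
(`codim_addMap_le_add`). Induction on the degree and on the number of variables bounds the right
side by the lowerings of `a - c` in degree `m - 1` and of `c` in degree `m` with one variable fewer.
A purely numerical statement, `le_moduleLower`, then forces `c ≤ a_{m,r}`; its core is
`macaulayLower_split_le`, the case of ideals.

The ring never changes in this induction. The modules are families of subspaces of one fixed `F`,
and the number of variables is replaced by the codimension of the space `killed` of linear forms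
that annihilate `F/N`.

For a lex-segment the dimension is computed exactly whenever the last variable occurs in `ℓ`: it is
the number of monomials outside the segment not divisible by the last variable
(`IsLexInDegree.hilbQuot_addForm`), and that number is counted by `card_filter_last_eq_moduleLower`.

One open set serves all degrees: outside finitely many degrees a generic `ℓ` is a nonzerodivisor on
`F/M`, and the dimension of `(F/M)_ℓ` in the next degree is then the same for all such `ℓ`
(`exists_finite_generic_mem`). -/

theorem macaulayLower_choose {d t : ℕ} (h : d ≤ t) :
    macaulayLower d (t.choose d) = (t - 1).choose d := by
  cases d with
  | zero => simp [macaulayLower]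
  | succ d =>
    have ht : topCoeff (d + 1) (t.choose (d + 1)) = t :=
      topCoeff_eq le_rfl (choose_lt_of_lt (by omega) (by omega))
    rw [macaulayLower, ht, Nat.sub_self, macaulayLower_zero, add_zero]

/-- The value `x = C(t, d)` is allowed although the greedy representation then starts with `t + 1`:
Pascal's rule, for `t` and for `t - 1`, makes both computations agree. Later inductions peel off a
leading binomial without separating this boundary case. -/
theorem macaulayLower_choose_add {d t x : ℕ} (ht : d + 1 ≤ t) (hx : x ≤ t.choose d) :
    macaulayLower (d + 1) (t.choose (d + 1) + x) = (t - 1).choose (d + 1) + macaulayLower d x := by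
  have hp := Nat.choose_succ_succ t d
  simp only [Nat.succ_eq_add_one] at hp
  rcases hx.lt_or_eq with hx | rfl
  · have h : topCoeff (d + 1) (t.choose (d + 1) + x) = t := topCoeff_eq (by omega) (by omega)
    rw [macaulayLower, h, Nat.add_sub_cancel_left]
  · rw [add_comm (t.choose (d + 1)), ← hp, macaulayLower_choose (by omega),
      macaulayLower_choose (by omega)]
    obtain ⟨s, rfl⟩ : ∃ s, t = s + 1 := ⟨t - 1, by omega⟩
    have := Nat.choose_succ_succ s d
    simp only [Nat.succ_eq_add_one, Nat.add_sub_cancel] at *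
    omega

theorem exists_eq_choose_add (d : ℕ) {a : ℕ} (ha : 0 < a) :
    ∃ t x, d + 1 ≤ t ∧ x < t.choose d ∧ a = t.choose (d + 1) + x := by
  obtain ⟨h1, h2⟩ := topCoeff_spec d a
  set t := topCoeff (d + 1) a
  have hp := Nat.choose_succ_succ t d
  simp only [Nat.succ_eq_add_one] at hp
  refine ⟨t, a - t.choose (d + 1), ?_, by omega, by omega⟩
  by_contra hh
  have := Nat.choose_le_choose (d + 1) (show t + 1 ≤ d + 1 by omega)
  simp at this
  omega

theorem macaulayLower_one (d : ℕ) : macaulayLower (d + 1) 1 = 0 := by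
  have := macaulayLower_choose (le_refl (d + 1))
  simpa using this

/-- Adding `1` to `a` adds `1` to the remainder after the leading binomial, and the remainder may
reach the boundary allowed in `macaulayLower_choose_add`; so the claim descends to degree `0`, where
the lowering is the identity. -/
theorem macaulayLower_succ (d a : ℕ) : macaulayLower d a ≤ macaulayLower d (a + 1) ∧
    macaulayLower d (a + 1) ≤ macaulayLower d a + 1 := by
  induction d generalizing a with
  | zero => simp [macaulayLower]
  | succ d ih =>
    rcases Nat.eq_zero_or_pos a with rfl | ha
    · simp [macaulayLower_zero, macaulayLower_one]
    · obtain ⟨t, x, ht, hx, rfl⟩ := exists_eq_choose_add d ha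
      rw [add_assoc, macaulayLower_choose_add ht hx.le, macaulayLower_choose_add ht hx]
      have := ih x
      simp only [Nat.succ_eq_add_one] at *
      omega

theorem macaulayLower_mono (d : ℕ) : Monotone (macaulayLower d) :=
  monotone_nat_of_le_succ fun a => (macaulayLower_succ d a).1

theorem macaulayLower_add_le (d a b : ℕ) : macaulayLower d (a + b) ≤ macaulayLower d a + b := by
  induction b with
  | zero => simp
  | succ b ih => have := (macaulayLower_succ d (a + b)).2; rw [← add_assoc]; omega

theorem macaulayLower_le (d a : ℕ) : macaulayLower d a ≤ a := by
  simpa [macaulayLower_zero] using macaulayLower_add_le d 0 a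

theorem macaulayLower_lt (d : ℕ) {a : ℕ} (ha : 0 < a) : macaulayLower (d + 1) a < a := by
  have := macaulayLower_add_le (d + 1) 1 (a - 1)
  rw [macaulayLower_one, show 1 + (a - 1) = a by omega] at this
  omega

theorem macaulayLower_deg_one (a : ℕ) : macaulayLower 1 a = a - 1 := by
  rcases Nat.eq_zero_or_pos a with rfl | ha
  · simp [macaulayLower_zero]
  · simpa using macaulayLower_choose (d := 1) (t := a) ha

/-- The lowering jumps exactly at binomial coefficients: by Pascal, `C(t, d+1) - 1` is a leading
binomial with top `t - 1` plus a remainder of the same form one degree lower. For `t = d + 1` the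
right side is `0`, hence the condition on `t`. -/
theorem macaulayLower_lt_choose {d t x : ℕ} (ht : d + 2 ≤ t) (hx : x < t.choose (d + 1)) :
    macaulayLower (d + 1) x < (t - 1).choose (d + 1) := by
  induction d generalizing t x with
  | zero =>
    simp only [zero_add, Nat.choose_one_right, macaulayLower_deg_one] at *
    omega
  | succ d ih =>
    obtain ⟨s, rfl⟩ : ∃ s, t = s + 1 := ⟨t - 1, by omega⟩
    have h2 := Nat.choose_succ_succ s (d + 1)
    simp only [Nat.succ_eq_add_one] at h2
    have hpos : 0 < s.choose (d + 1) := Nat.choose_pos (by omega)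
    have h3 := macaulayLower_mono (d + 1 + 1)
      (show x ≤ s.choose (d + 1 + 1) + (s.choose (d + 1) - 1) by omega)
    rw [macaulayLower_choose_add (by omega) (by omega)] at h3
    have h4 := ih (t := s) (x := s.choose (d + 1) - 1) (by omega) (by omega)
    obtain ⟨u, rfl⟩ : ∃ u, s = u + 1 := ⟨s - 1, by omega⟩
    have h5 := Nat.choose_succ_succ u (d + 1)
    simp only [Nat.succ_eq_add_one, Nat.add_sub_cancel] at *
    omega

theorem sub_macaulayLower_mono (d : ℕ) {a b : ℕ} (h : a ≤ b) :
    a - macaulayLower d a ≤ b - macaulayLower d b := by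
  have h1 := macaulayLower_add_le d a (b - a)
  rw [show a + (b - a) = b by omega] at h1
  have := macaulayLower_le d a
  omega

/-- With `g = a⟨d+1⟩`, this says that `c = g + 1` violates `c ≤ (a - c)⟨d⟩ + c⟨d+1⟩`. If `a = C(t,
d+1) + x`, then `a - g - 1` and `g + 1` have leading binomials `C(t-1, d)` and `C(t-1, d+1)`. Their
lowerings add up to `C(t-1, d+1)`, and what remains is the claim for `x` one degree lower. -/
theorem macaulayLower_split_le (d : ℕ) {a : ℕ} (ha : 0 < a) :
    macaulayLower d (a - macaulayLower (d + 1) a - 1)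
      + macaulayLower (d + 1) (macaulayLower (d + 1) a + 1) ≤ macaulayLower (d + 1) a := by
  induction d generalizing a with
  | zero =>
    have h := macaulayLower_le 0 (a - macaulayLower 1 a - 1)
    simp only [zero_add, macaulayLower_deg_one] at *
    omega
  | succ e ih =>
    obtain ⟨t, x, ht, hx, rfl⟩ := exists_eq_choose_add (e + 1) ha
    rw [macaulayLower_choose_add ht hx.le]
    have hlt : macaulayLower (e + 1) x < (t - 1).choose (e + 1) :=
      macaulayLower_lt_choose ht hx
    rcases ht.lt_or_eq with ht' | rfl
    · obtain ⟨u, rfl⟩ : ∃ u, t = u + 2 := ⟨t - 2, by omega⟩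
      have p1 := Nat.choose_succ_succ (u + 1) (e + 1)
      have p2 := Nat.choose_succ_succ (u + 1) e
      have p3 := Nat.choose_succ_succ u e
      have p4 := Nat.choose_succ_succ u (e + 1)
      have q2 : u + 1 - 1 = u := rfl
      simp only [Nat.succ_eq_add_one] at p1 p2 p3 p4
      rw [show (u + 2 - 1) = u + 1 from rfl] at hlt ⊢
      rw [add_assoc ((u + 1).choose (e + 1 + 1)), macaulayLower_choose_add (t := u + 1) (by omega)
        (by omega), q2]
      -- For `x = 0` the induction hypothesis is not available; there `a - g - 1 = C(t-1, e+1) - 1`,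
      -- and monotonicity suffices.
      rcases Nat.eq_zero_or_pos x with rfl | hx0
      · rw [macaulayLower_zero, zero_add, macaulayLower_one]
        have := macaulayLower_mono (e + 1) (show (u + 2).choose (e + 1 + 1) + 0 -
          ((u + 1).choose (e + 1 + 1) + 0) - 1 ≤ (u + 1).choose (e + 1) by
            rw [show u + 2 = u + 1 + 1 from rfl, p1]; omega)
        rw [macaulayLower_choose (by omega), q2] at this
        omega
      · have h1 := macaulayLower_lt e hx0
        have h2 := sub_macaulayLower_mono (e + 1) hx.le
        rw [macaulayLower_choose (by omega), show u + 2 - 1 = u + 1 from rfl, show u + 2 = u + 1 + 1 from rfl, p2] at h2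
        have h3 : (u + 2).choose (e + 1 + 1) + x - ((u + 1).choose (e + 1 + 1)
          + macaulayLower (e + 1) x) - 1
            = (u + 1).choose (e + 1) + (x - macaulayLower (e + 1) x - 1) := by
          rw [show u + 2 = u + 1 + 1 from rfl, p1]; omega
        rw [h3, macaulayLower_choose_add (by omega) (by omega), q2]
        have := ih hx0
        omega
    · have h0 : macaulayLower (e + 1) x = 0 := by simpa using hlt
      simp [h0, macaulayLower_one]

/-- The numerical step of the restriction theorem for ideals. -/
theorem le_macaulayLower {d a c : ℕ} (hca : c ≤ a)
    (h : c ≤ macaulayLower d (a - c) + macaulayLower (d + 1) c) : c ≤ macaulayLower (d + 1) a := by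
  by_contra hc
  push Not at hc
  -- Every `c` above the lowering of `a` fails because its successor fails: raising `c` further
  -- decreases the first summand and raises the second by at most the increase of `c`.
  have h1 := macaulayLower_split_le d (show 0 < a by omega)
  have h2 := macaulayLower_mono d (show a - c ≤ a - macaulayLower (d + 1) a - 1 by omega)
  have h3 := macaulayLower_add_le (d + 1) (macaulayLower (d + 1) a + 1)
    (c - (macaulayLower (d + 1) a + 1))
  rw [show macaulayLower (d + 1) a + 1 + (c - (macaulayLower (d + 1) a + 1)) = c by omega] at h3
  omega

/-! ### Numerical properties of `a_{m,r}` -/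

theorem polyDim_of_neg {n : ℕ} {d : ℤ} (h : d < 0) : polyDim n d = 0 := by
  simp [polyDim, h]

theorem polyDim_natCast (n d : ℕ) : polyDim n (d : ℤ) = (n + d - 1).choose d := by
  simp [polyDim]

/-- Monomials are either divisible by a chosen variable or free of it. -/
theorem polyDim_succ (n : ℕ) (d : ℤ) :
    polyDim (n + 1) d = polyDim (n + 1) (d - 1) + polyDim n d := by
  rcases lt_or_ge d 0 with h | h
  · simp [polyDim_of_neg h, polyDim_of_neg (show d - 1 < 0 by omega)]
  · lift d to ℕ using h
    cases d with
    | zero => simp [polyDim]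
    | succ d =>
      rw [show ((d + 1 : ℕ) : ℤ) - 1 = (d : ℕ) by push_cast; ring]
      simp only [polyDim_natCast]
      convert Nat.choose_succ_succ (n + d) d using 3 <;> omega

theorem polyDim_mono (d : ℤ) : Monotone fun n => polyDim n d :=
  monotone_nat_of_le_succ fun n => by rw [polyDim_succ]; omega

theorem macaulayLower_polyDim (n : ℕ) (d : ℤ) :
    macaulayLower d.toNat (polyDim (n + 1) d) = polyDim n d := by
  rcases lt_or_ge d 0 with h | h
  · simp [polyDim_of_neg h, macaulayLower_zero]
  · lift d to ℕ using h
    simp only [Int.toNat_natCast, polyDim_natCast]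
    rw [macaulayLower_choose (by omega)]
    congr 1
    omega

section

variable {r : ℕ}

/-- `dim_k F_m`, where the generators of `F` have the degrees `f i`. -/
def totalDim (n : ℕ) (f : Fin r → ℤ) (m : ℤ) : ℕ := ∑ i, polyDim n (m - f i)

theorem totalDim_succ (n : ℕ) (f : Fin r → ℤ) (m : ℤ) :
    totalDim (n + 1) f m = totalDim (n + 1) f (m - 1) + totalDim n f m := by
  simp only [totalDim, ← Finset.sum_add_distrib]
  refine Finset.sum_congr rfl fun i _ => ?_
  rw [polyDim_succ, show m - f i - 1 = m - 1 - f i by ring]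

theorem totalDim_mono (f : Fin r → ℤ) (m : ℤ) : Monotone fun n => totalDim n f m :=
  fun _ _ h => Finset.sum_le_sum fun _ _ => polyDim_mono _ h

theorem sum_Ici_eq (N : Fin r → ℕ) (j : Fin r) :
    ∑ i ∈ Finset.Ici j, N i = N j + ∑ i ∈ Finset.Ioi j, N i := by
  rw [← Finset.Ioi_insert, Finset.sum_insert (by simp)]

theorem sum_Ici_le_sum_Ioi (N : Fin r → ℕ) {i j : Fin r} (h : i < j) :
    ∑ l ∈ Finset.Ici j, N l ≤ ∑ l ∈ Finset.Ioi i, N l :=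
  Finset.sum_le_sum_of_subset fun l hl => by
    simp only [Finset.mem_Ici, Finset.mem_Ioi] at *
    exact lt_of_lt_of_le h hl

/-- A sum over the shares `min (N i) (a - ∑ l > i, N l)` of `a`, filled up from the last index. -/
theorem sum_min_sub_eq {N : Fin r → ℕ} {a : ℕ} {j : Fin r} (h1 : ∑ i ∈ Finset.Ioi j, N i ≤ a)
    (h2 : a ≤ ∑ i ∈ Finset.Ici j, N i) (h : Fin r → ℕ → ℕ) (h0 : ∀ i, h i 0 = 0) :
    ∑ i, h i (min (N i) (a - ∑ l ∈ Finset.Ioi i, N l))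
      = h j (a - ∑ i ∈ Finset.Ioi j, N i) + ∑ i ∈ Finset.Ioi j, h i (N i) := by
  have hz : ∑ i ∈ Finset.Iio j, h i (min (N i) (a - ∑ l ∈ Finset.Ioi i, N l)) = 0 := by
    refine Finset.sum_eq_zero fun i hi => ?_
    have := sum_Ici_le_sum_Ioi N (Finset.mem_Iio.mp hi)
    rw [show a - ∑ l ∈ Finset.Ioi i, N l = 0 by omega, Nat.min_zero, h0]
  have hu : (Finset.univ : Finset (Fin r)) = Finset.Iio j ∪ insert j (Finset.Ioi j) := by
    ext i
    simp only [Finset.mem_univ, Finset.mem_union, Finset.mem_Iio, Finset.mem_insert,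
      Finset.mem_Ioi, true_iff]
    rcases lt_trichotomy i j with h | h | h <;> simp [h]
  have hd : Disjoint (Finset.Iio j) (insert j (Finset.Ioi j)) := by
    rw [Finset.disjoint_left]
    intro i hi hi'
    simp only [Finset.mem_Iio, Finset.mem_insert, Finset.mem_Ioi] at hi hi'
    rcases hi' with rfl | h
    · exact lt_irrefl _ hi
    · exact lt_irrefl _ (hi.trans h)
  rw [hu, Finset.sum_union hd, hz, zero_add, Finset.sum_insert (by simp)]
  have hj := sum_Ici_eq N j
  congr 1
  · rw [Nat.min_eq_right (by omega)]
  · refine Finset.sum_congr rfl fun i hi => ?_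
    have := sum_Ici_le_sum_Ioi N (Finset.mem_Ioi.mp hi)
    have := sum_Ici_eq N i
    rw [Nat.min_eq_left (by omega)]

theorem sum_Ici_zero (N : Fin (r + 1) → ℕ) : ∑ l ∈ Finset.Ici (0 : Fin (r + 1)), N l = ∑ i, N i := by
  congr 1
  ext i
  simp

theorem exists_split_lt {N : Fin r → ℕ} {a : ℕ} (ha : a < ∑ i, N i) :
    ∃ j, ∑ i ∈ Finset.Ioi j, N i ≤ a ∧ a < ∑ i ∈ Finset.Ici j, N i := by
  classical
  let T := Finset.univ.filter fun j : Fin r => a < ∑ i ∈ Finset.Ici j, N i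
  have hT : T.Nonempty := by
    cases r with
    | zero => simp at ha
    | succ r => exact ⟨0, by simpa [T, sum_Ici_zero] using ha⟩
  refine ⟨T.max' hT, ?_, (Finset.mem_filter.mp (T.max'_mem hT)).2⟩
  set j := T.max' hT with hj
  by_cases hlast : (j : ℕ) + 1 < r
  · have hI : Finset.Ioi j = Finset.Ici (⟨j + 1, hlast⟩ : Fin r) := by
      ext i
      simp only [Finset.mem_Ioi, Finset.mem_Ici, Fin.lt_def, Fin.le_def]
      omega
    rw [hI]
    by_contra hh
    have hmem : (⟨j + 1, hlast⟩ : Fin r) ∈ T := by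
      simp only [T, Finset.mem_filter, Finset.mem_univ, true_and]
      omega
    have := T.le_max' _ hmem
    rw [← hj, Fin.le_def] at this
    simp at this
  · have hI : Finset.Ioi j = ∅ := by
      ext i
      simp only [Finset.mem_Ioi, Fin.lt_def, Finset.notMem_empty, iff_false]
      omega
    rw [hI]
    simp

theorem sum_min_sub {N : Fin r → ℕ} {a : ℕ} (ha : a ≤ ∑ i, N i) :
    ∑ i, min (N i) (a - ∑ l ∈ Finset.Ioi i, N l) = a := by
  rcases ha.lt_or_eq with h | rfl
  · obtain ⟨j, h1, h2⟩ := exists_split_lt h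
    rw [sum_min_sub_eq h1 h2.le (fun _ x => x) fun _ => rfl]
    omega
  · refine Finset.sum_congr rfl fun i _ => Nat.min_eq_left ?_
    have := sum_Ici_eq N i
    have : ∑ l ∈ Finset.Ici i, N l ≤ ∑ l, N l := Finset.sum_le_sum_of_subset (by simp)
    omega

/-- Writing `a` as shares filled up from the last summand removes the choice of `j`, so that
properties of `macaulayLower` can be applied summand by summand. -/
theorem moduleLower_eq_sum (n : ℕ) (f : Fin r → ℤ) (m : ℤ) {a : ℕ} (ha : a ≤ totalDim n f m) :
    moduleLower n f m a = ∑ i, macaulayLower (m - f i).toNat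
      (min (polyDim n (m - f i)) (a - ∑ l ∈ Finset.Ioi i, polyDim n (m - f l))) := by
  rcases Nat.eq_zero_or_pos r with rfl | hr
  · simp [moduleLower]
  · obtain ⟨j, hj⟩ := exists_isSplitIndex n hr f m a ha
    rw [moduleLower_eq n f m a j hj, splitValue_eq n f m a j hj]

theorem moduleLower_mono (n : ℕ) (f : Fin r → ℤ) (m : ℤ) {a b : ℕ} (hab : a ≤ b)
    (hb : b ≤ totalDim n f m) : moduleLower n f m a ≤ moduleLower n f m b := by
  rw [moduleLower_eq_sum n f m hb, moduleLower_eq_sum n f m (hab.trans hb)]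
  exact Finset.sum_le_sum fun i _ => macaulayLower_mono _ (by omega)

theorem moduleLower_add_le (n : ℕ) (f : Fin r → ℤ) (m : ℤ) {a b : ℕ}
    (hb : a + b ≤ totalDim n f m) : moduleLower n f m (a + b) ≤ moduleLower n f m a + b := by
  have h1 := sum_min_sub (N := fun i => polyDim n (m - f i)) hb
  have h2 := sum_min_sub (N := fun i => polyDim n (m - f i)) ((Nat.le_add_right a b).trans hb)
  rw [moduleLower_eq_sum n f m hb, moduleLower_eq_sum n f m ((Nat.le_add_right a b).trans hb)]
  -- The shares sum to `a` and to `a + b`; adding them crosswise makes the comparison termwise and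
  -- free of truncated subtraction.
  suffices h : ∑ i, macaulayLower (m - f i).toNat
      (min (polyDim n (m - f i)) (a + b - ∑ l ∈ Finset.Ioi i, polyDim n (m - f l)))
      + ∑ i, min (polyDim n (m - f i)) (a - ∑ l ∈ Finset.Ioi i, polyDim n (m - f l))
      ≤ ∑ i, macaulayLower (m - f i).toNat
      (min (polyDim n (m - f i)) (a - ∑ l ∈ Finset.Ioi i, polyDim n (m - f l)))
      + ∑ i, min (polyDim n (m - f i)) (a + b - ∑ l ∈ Finset.Ioi i, polyDim n (m - f l)) by
    omega
  simp only [← Finset.sum_add_distrib]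
  refine Finset.sum_le_sum fun i _ => ?_
  set x := min (polyDim n (m - f i)) (a - ∑ l ∈ Finset.Ioi i, polyDim n (m - f l))
  set y := min (polyDim n (m - f i)) (a + b - ∑ l ∈ Finset.Ioi i, polyDim n (m - f l))
  have hxy : x ≤ y := by omega
  have := macaulayLower_add_le (m - f i).toNat x (y - x)
  rw [show x + (y - x) = y by omega] at this
  omega

theorem moduleLower_totalDim (n : ℕ) (f : Fin r → ℤ) (m : ℤ) :
    moduleLower (n + 1) f m (totalDim (n + 1) f m) = totalDim n f m := by
  rw [moduleLower_eq_sum _ f m le_rfl]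
  refine Finset.sum_congr rfl fun i _ => ?_
  have := sum_Ici_eq (fun i => polyDim (n + 1) (m - f i)) i
  have : ∑ l ∈ Finset.Ici i, polyDim (n + 1) (m - f l) ≤ totalDim (n + 1) f m :=
    Finset.sum_le_sum_of_subset (by simp)
  rw [Nat.min_eq_left (by omega), macaulayLower_polyDim]

/-- Below the number of generators of degree `m` nothing is lost. -/
theorem moduleLower_of_le (n : ℕ) {f : Fin r → ℤ} (hf : Monotone f) (m : ℤ) {a : ℕ}
    (ha : a ≤ totalDim 0 f m) : moduleLower n f m a = a := by
  have han : a ≤ totalDim n f m := ha.trans (totalDim_mono f m (Nat.zero_le n))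
  rw [moduleLower_eq_sum n f m han]
  conv_rhs => rw [← sum_min_sub (N := fun i => polyDim n (m - f i)) han]
  refine Finset.sum_congr rfl fun i _ => ?_
  -- In degrees `≤ 0` the lowering is the identity. If `d_i > 0`, then by monotonicity of `f` all
  -- generators of degree `m` come after `i`; they already absorb `a`, and the share of `i` is `0`.
  rcases le_or_gt (m - f i) 0 with h | h
  · rw [Int.toNat_of_nonpos h, macaulayLower]
  · suffices hs : a ≤ ∑ l ∈ Finset.Ioi i, polyDim n (m - f l) by
      simp [Nat.sub_eq_zero_of_le hs, macaulayLower_zero]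
    refine ha.trans ?_
    have hs : totalDim 0 f m = ∑ l ∈ Finset.Ioi i, polyDim 0 (m - f l) := by
      refine (Finset.sum_subset (Finset.subset_univ _) fun l _ hl => ?_).symm
      have hl' : f l ≤ f i := hf (by simpa using hl)
      rw [← Int.toNat_of_nonneg (show 0 ≤ m - f l by omega), polyDim_natCast]
      exact Nat.choose_eq_zero_of_lt (by omega)
    rw [hs]
    exact Finset.sum_le_sum fun l _ => polyDim_mono _ (Nat.zero_le n)

/-- The value of `moduleLower` on `N_{j+1} + ⋯ + N_r + x`. -/
theorem moduleLower_sum_add (n : ℕ) (f : Fin r → ℤ) (m : ℤ) (j : Fin r) {x : ℕ}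
    (hx : x ≤ polyDim (n + 1) (m - f j)) :
    moduleLower (n + 1) f m (∑ i ∈ Finset.Ioi j, polyDim (n + 1) (m - f i) + x)
      = ∑ i ∈ Finset.Ioi j, polyDim n (m - f i) + macaulayLower (m - f j).toNat x := by
  rw [moduleLower_eq _ f m _ j, splitValue, Nat.add_sub_cancel_left, add_comm]
  · simp only [macaulayLower_polyDim]
  · refine ⟨by omega, ?_⟩
    rw [sum_Ici_eq]
    omega

/-- Strictness needs two variables: with a single variable and positive degree the bound on the
right would be `0`. -/
theorem macaulayLower_lt_polyDim {n : ℕ} {d : ℤ} {x : ℕ} (hx : x < polyDim (n + 2) d) :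
    macaulayLower d.toNat x < polyDim (n + 1) d := by
  have h0 : 0 ≤ d := by
    by_contra h
    simp [polyDim_of_neg (not_le.mp h)] at hx
  lift d to ℕ using h0
  rw [polyDim_natCast] at *
  cases d with
  | zero => simpa [macaulayLower] using hx
  | succ d =>
    have h := macaulayLower_lt_choose (d := d) (t := n + d + 2) (by omega)
      (by convert hx using 2; omega)
    convert h using 2 <;> omega

/-- The numerical step of the restriction theorem for modules. -/
theorem le_moduleLower {n : ℕ} {f : Fin r → ℤ} (hf : Monotone f) {m : ℤ} {a c : ℕ}
    (ha : a ≤ totalDim (n + 2) f m) (hca : c ≤ a) (hc : c ≤ totalDim (n + 1) f m)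
    (hac : a - c ≤ totalDim (n + 2) f (m - 1))
    (h : c ≤ moduleLower (n + 2) f (m - 1) (a - c) + moduleLower (n + 1) f m c) :
    c ≤ moduleLower (n + 2) f m a := by
  -- If `a` is the full dimension, the claim is `hc`. Otherwise `a = T + b`, where `T` collects the
  -- summands after some `j` and `b` is a proper part of the `j`-th one, so the problem lives in a
  -- single summand.
  rcases ha.lt_or_eq with hlt | rfl
  swap
  · rwa [moduleLower_totalDim]
  by_contra hcon
  push Not at hcon
  obtain ⟨j, hj1, hj2⟩ := exists_split_lt hlt
  rw [sum_Ici_eq (fun i => polyDim (n + 2) (m - f i))] at hj2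
  have hshift : ∀ i, m - 1 - f i = m - f i - 1 := fun i => by ring
  set T := ∑ i ∈ Finset.Ioi j, polyDim (n + 2) (m - f i) with hT
  set T1 := ∑ i ∈ Finset.Ioi j, polyDim (n + 1) (m - f i) with hT1
  set T2 := ∑ i ∈ Finset.Ioi j, polyDim n (m - f i) with hT2
  set D := ∑ i ∈ Finset.Ioi j, polyDim (n + 2) (m - 1 - f i) with hD
  set D1 := ∑ i ∈ Finset.Ioi j, polyDim (n + 1) (m - 1 - f i) with hD1
  have hTD : T = D + T1 := by
    rw [hT, hD, hT1, ← Finset.sum_add_distrib]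
    exact Finset.sum_congr rfl fun i _ => by rw [polyDim_succ, hshift]
  have hTD1 : T1 = D1 + T2 := by
    rw [hT1, hD1, hT2, ← Finset.sum_add_distrib]
    exact Finset.sum_congr rfl fun i _ => by rw [polyDim_succ, hshift]
  obtain ⟨b, rfl⟩ : ∃ b, a = T + b := ⟨a - T, by omega⟩
  have hb : b < polyDim (n + 2) (m - f j) := by omega
  have hd : 0 ≤ m - f j := by
    by_contra hneg
    simp [polyDim_of_neg (not_le.mp hneg)] at hb
  have hG : moduleLower (n + 2) f m (T + b) = T1 + macaulayLower (m - f j).toNat b :=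
    moduleLower_sum_add (n + 1) f m j hb.le
  rw [hG] at hcon
  set g := macaulayLower (m - f j).toNat b with hg
  have hgN : g < polyDim (n + 1) (m - f j) := macaulayLower_lt_polyDim hb
  have hgb : g ≤ b := macaulayLower_le _ _
  -- reduce to the smallest possible value of `c`
  have h1 : moduleLower (n + 1) f m c ≤ moduleLower (n + 1) f m (T1 + (g + 1))
      + (c - (T1 + (g + 1))) := by
    have := moduleLower_add_le (n + 1) f m (a := T1 + (g + 1)) (b := c - (T1 + (g + 1)))
      (by omega)
    rwa [show T1 + (g + 1) + (c - (T1 + (g + 1))) = c by omega] at this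
  have h2 : moduleLower (n + 1) f m (T1 + (g + 1))
      = T2 + macaulayLower (m - f j).toNat (g + 1) := moduleLower_sum_add n f m j hgN
  -- If `g < b`, then `d_j ≥ 1`. The full summands after `j` cancel by `hTD` and `hTD1`, which
  -- leaves the inequality of `le_macaulayLower` for `b` and `g + 1`, contradicting `g = b⟨d_j⟩`.
  by_cases hbg : g < b
  · obtain ⟨d, hdd⟩ : ∃ d : ℕ, m - f j = (d + 1 : ℕ) := by
      refine ⟨(m - f j).toNat - 1, ?_⟩
      have : (m - f j).toNat ≠ 0 := by
        intro h0
        rw [h0, macaulayLower] at hg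
        omega
      omega
    have hd1 : m - 1 - f j = (d : ℕ) := by push_cast at hdd; omega
    have hle : T + b - c ≤ D + (b - (g + 1)) := by omega
    have hb1 : b - (g + 1) ≤ polyDim (n + 2) (m - 1 - f j) := by
      have h3 := sub_macaulayLower_mono (m - f j).toNat hb.le
      have h4 : macaulayLower (m - f j).toNat (polyDim (n + 2) (m - f j))
          = polyDim (n + 1) (m - f j) := macaulayLower_polyDim (n + 1) (m - f j)
      have h5 : polyDim (n + 2) (m - f j) = polyDim (n + 2) (m - f j - 1)
          + polyDim (n + 1) (m - f j) := polyDim_succ (n + 1) (m - f j)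
      rw [h4, ← hg] at h3
      rw [hshift]
      omega
    have h4 : moduleLower (n + 2) f (m - 1) (D + (b - (g + 1)))
        = D1 + macaulayLower (m - 1 - f j).toNat (b - (g + 1)) :=
      moduleLower_sum_add (n + 1) f (m - 1) j hb1
    have h5 : D + (b - (g + 1)) ≤ totalDim (n + 2) f (m - 1) := by
      have h6 : ∑ i ∈ Finset.Ici j, polyDim (n + 2) (m - 1 - f i) ≤ totalDim (n + 2) f (m - 1) :=
        Finset.sum_le_sum_of_subset (by simp)
      rw [sum_Ici_eq (fun i => polyDim (n + 2) (m - 1 - f i))] at h6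
      omega
    have h7 := moduleLower_mono (n + 2) f (m - 1) hle h5
    rw [hd1, Int.toNat_natCast] at h4
    rw [hdd, Int.toNat_natCast] at h2 hg
    have h8 := le_macaulayLower (d := d) (a := b) (c := g + 1) hbg (by omega)
    omega
  · have hgb' : g = b := by omega
    -- If `d_j = 0`, the generators after `j` contribute nothing in degree `m - 1`, since `f` is
    -- monotone; so `T = T1` and `c > a`. If `d_j > 0`, a positive number is lowered strictly, so `b
    -- = 0`.
    rcases Nat.eq_zero_or_pos (m - f j).toNat with h0 | hpos
    · have hD0 : D = 0 := Finset.sum_eq_zero fun i hi => by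
        have := hf (Finset.mem_Ioi.mp hi).le
        exact polyDim_of_neg (by omega)
      omega
    · obtain ⟨e, he⟩ : ∃ e, (m - f j).toNat = e + 1 := ⟨(m - f j).toNat - 1, by omega⟩
      have hb0 : b = 0 := by
        by_contra hne
        have := macaulayLower_lt e (Nat.pos_of_ne_zero hne)
        rw [← he] at this
        omega
      subst hb0
      rw [hgb', he, zero_add, macaulayLower_one] at h2
      have h5 : D ≤ totalDim (n + 2) f (m - 1) := Finset.sum_le_sum_of_subset (by simp)
      have h7 := moduleLower_mono (n + 2) f (m - 1) (show T + 0 - c ≤ D by omega) h5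
      have h4 : moduleLower (n + 2) f (m - 1) (D + 0) = D1 + _ :=
        moduleLower_sum_add (n + 1) f (m - 1) j (Nat.zero_le _)
      rw [macaulayLower_zero, add_zero] at h4
      rw [hgb', zero_add] at h1
      omega

end

end GreenModule

namespace GreenModule

open Module

/-! ### Generic vectors -/

section Generic

variable {k : Type*} [Field k] {n : ℕ}

/-- `P` holds off the zero set of a nonzero polynomial. -/
def Generic (P : (Fin n → k) → Prop) : Prop :=
  ∃ p : MvPolynomial (Fin n) k, p ≠ 0 ∧ ∀ c, MvPolynomial.eval c p ≠ 0 → P c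

theorem Generic.mono {P Q : (Fin n → k) → Prop} (h : Generic P) (hPQ : ∀ c, P c → Q c) :
    Generic Q := by
  obtain ⟨p, hp, h⟩ := h
  exact ⟨p, hp, fun c hc => hPQ c (h c hc)⟩

theorem Generic.of_forall {P : (Fin n → k) → Prop} (h : ∀ c, P c) : Generic P :=
  ⟨1, one_ne_zero, fun c _ => h c⟩

theorem Generic.and {P Q : (Fin n → k) → Prop} (hP : Generic P) (hQ : Generic Q) :
    Generic fun c => P c ∧ Q c := by
  obtain ⟨p, hp, h⟩ := hP
  obtain ⟨q, hq, h'⟩ := hQ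
  refine ⟨p * q, mul_ne_zero hp hq, fun c hc => ?_⟩
  rw [map_mul] at hc
  exact ⟨h c (left_ne_zero_of_mul hc), h' c (right_ne_zero_of_mul hc)⟩

theorem Generic.forall_mem_finite {ι : Type*} {s : Set ι} (hs : s.Finite)
    {P : ι → (Fin n → k) → Prop} (h : ∀ i ∈ s, Generic (P i)) :
    Generic fun c => ∀ i ∈ s, P i c := by
  induction s, hs using Set.Finite.induction_on with
  | empty => exact .of_forall fun _ i hi => hi.elim
  | insert _ _ ih =>
    refine ((h _ (Set.mem_insert _ _)).and (ih fun i hi => h i (Set.mem_insert_of_mem _ hi))).mono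
      fun c hc i hi => ?_
    rcases hi with rfl | hi
    · exact hc.1
    · exact hc.2 i hi

theorem Generic.exists [Infinite k] {P : (Fin n → k) → Prop} (h : Generic P) : ∃ c, P c := by
  obtain ⟨p, hp, h⟩ := h
  by_contra! hc
  exact hp (MvPolynomial.funext fun c => by
    rw [map_zero]
    by_contra hne
    exact hc c (h c hne))

theorem sum_smul_single_one (c : Fin n → k) : ∑ i, c i • (Pi.single i 1 : Fin n → k) = c := by
  simpa using (Pi.basisFun k (Fin n)).sum_repr c

theorem generic_apply_ne_zero {φ : (Fin n → k) →ₗ[k] k} (hφ : φ ≠ 0) :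
    Generic fun c => φ c ≠ 0 := by
  have hev : ∀ c, MvPolynomial.eval c
      (∑ i, MvPolynomial.C (φ (Pi.single i 1)) * MvPolynomial.X i) = φ c := by
    intro c
    conv_rhs => rw [← sum_smul_single_one c]
    simp [mul_comm]
  refine ⟨∑ i, MvPolynomial.C (φ (Pi.single i 1)) * MvPolynomial.X i, fun h0 => hφ ?_,
    fun c hc => by rwa [hev] at hc⟩
  refine LinearMap.ext fun c => ?_
  rw [LinearMap.zero_apply, ← hev, h0, map_zero]

theorem generic_notMem {V : Submodule k (Fin n → k)} (hV : V ≠ ⊤) : Generic fun c => c ∉ V := by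
  obtain ⟨φ, hφ, hVφ⟩ := V.exists_le_ker_of_lt_top hV.lt_top
  exact (generic_apply_ne_zero hφ).mono fun c hc hcV => hc (hVφ hcV)

/-- The rank of a linear family of linear maps is lower semicontinuous. -/
theorem generic_finrank_range_le {E₁ E₂ : Type*} [AddCommGroup E₁] [Module k E₁]
    [FiniteDimensional k E₁] [AddCommGroup E₂] [Module k E₂]
    (φ : (Fin n → k) →ₗ[k] E₁ →ₗ[k] E₂) (c₀ : Fin n → k) :
    Generic fun c => finrank k (LinearMap.range (φ c₀)) ≤ finrank k (LinearMap.range (φ c)) := by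
  classical
  set ρ := finrank k (LinearMap.range (φ c₀)) with hρ
  let b := finBasis k (LinearMap.range (φ c₀))
  have hv : ∀ i, ∃ v, φ c₀ v = b i := fun i => (b i).2
  choose v hv using hv
  have hli : LinearIndependent k fun i => φ c₀ (v i) := by
    simp only [hv]
    exact b.linearIndependent.map' _ (Submodule.ker_subtype _)
  -- The left inverse `h` reads off coordinates with respect to the vectors `φ c₀ (v i)`. The matrix
  -- of `h (φ c (v i))` is linear in `c` and is the identity at `c₀`, so its determinant is a
  -- nonzero polynomial; where it does not vanish, the vectors `φ c (v i)` are independent.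
  obtain ⟨h, hh⟩ := (Fintype.linearCombination k fun i => φ c₀ (v i)).exists_leftInverse_of_injective
    (LinearMap.ker_eq_bot.mpr (linearIndependent_iff_injective_fintypeLinearCombination.mp hli))
  have hh' : ∀ i, h (φ c₀ (v i)) = Pi.single i 1 := by
    intro i
    have := LinearMap.congr_fun hh (Pi.single i 1)
    simpa [Fintype.linearCombination_apply_single] using this
  let A : Matrix (Fin ρ) (Fin ρ) (MvPolynomial (Fin n) k) := Matrix.of fun j i =>
    ∑ l, MvPolynomial.C (h (φ (Pi.single l 1) (v i)) j) * MvPolynomial.X l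
  have hA : ∀ c, A.map (MvPolynomial.eval c) = Matrix.of fun j i => h (φ c (v i)) j := by
    intro c
    ext j i
    simp only [A, Matrix.map_apply, Matrix.of_apply, map_sum, map_mul, MvPolynomial.eval_C,
      MvPolynomial.eval_X]
    conv_rhs => rw [← sum_smul_single_one c]
    simp [mul_comm]
  have hdet : ∀ c, MvPolynomial.eval c A.det = (Matrix.of fun j i => h (φ c (v i)) j).det := by
    intro c
    rw [RingHom.map_det, ← hA]
    rfl
  refine ⟨A.det, fun h0 => ?_, fun c hc => ?_⟩
  · have h1 := hdet c₀
    rw [show (Matrix.of fun j i => h (φ c₀ (v i)) j) = (1 : Matrix (Fin ρ) (Fin ρ) k) by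
      ext j i
      rw [Matrix.of_apply, hh', Matrix.one_apply, Pi.single_apply]] at h1
    simp [h0] at h1
  · rw [hdet] at hc
    have h1 := Matrix.linearIndependent_cols_of_det_ne_zero hc
    have h2 : LinearIndependent k fun i => φ c (v i) := LinearIndependent.of_comp h h1
    have h3 := finrank_span_eq_card h2
    rw [Fintype.card_fin] at h3
    rw [hρ, ← h3]
    refine Submodule.finrank_mono (Submodule.span_le.mpr ?_)
    rintro _ ⟨i, rfl⟩
    exact ⟨v i, rfl⟩

end Generic

/-! ### Dimension formulas -/

section Dimension

variable {k : Type*} [Field k] {E E' : Type*} [AddCommGroup E] [Module k E] [AddCommGroup E']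
  [Module k E']

theorem finrank_map_add_finrank_inf_ker (g : E →ₗ[k] E') (D : Submodule k E)
    [FiniteDimensional k D] :
    finrank k (D.map g) + finrank k (D ⊓ LinearMap.ker g : Submodule k E) = finrank k D := by
  have h := LinearMap.finrank_range_add_finrank_ker (g.domRestrict D)
  rwa [LinearMap.range_domRestrict, LinearMap.ker_domRestrict,
    ← Submodule.finrank_map_subtype_eq, Submodule.map_comap_subtype] at h

/-- Rank-nullity for the map `D → E/P` induced by `g`, whose kernel is `D ⊓ P.comap g`; stated
additively to avoid subtraction. -/
theorem finrank_sup_map_add_finrank_inf_comap (g : E →ₗ[k] E) (P D : Submodule k E)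
    [FiniteDimensional k P] [FiniteDimensional k D] :
    finrank k (P ⊔ D.map g : Submodule k E) + finrank k (D ⊓ P.comap g : Submodule k E)
      = finrank k P + finrank k D := by
  have h1 := Submodule.finrank_sup_add_finrank_inf_eq P (D.map g)
  have h2 := finrank_map_add_finrank_inf_ker g D
  have h3 := finrank_map_add_finrank_inf_ker g (D ⊓ P.comap g)
  have h4 : (D ⊓ P.comap g).map g = P ⊓ D.map g := by
    ext x
    constructor
    · rintro ⟨y, ⟨hy, hy'⟩, rfl⟩
      exact ⟨hy', y, hy, rfl⟩
    · rintro ⟨hx, y, hy, rfl⟩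
      exact ⟨y, ⟨hy, hx⟩, rfl⟩
  have h5 : D ⊓ P.comap g ⊓ LinearMap.ker g = D ⊓ LinearMap.ker g := by
    rw [inf_assoc]
    congr 1
    exact inf_eq_right.mpr fun x hx => by
      rw [Submodule.mem_comap, LinearMap.mem_ker.mp hx]
      exact P.zero_mem
  rw [h4, h5] at h3
  omega

theorem finrank_map_mkQ_add (P X : Submodule k E) [FiniteDimensional k X] :
    finrank k (X.map P.mkQ) + finrank k (X ⊓ P : Submodule k E) = finrank k X := by
  have := finrank_map_add_finrank_inf_ker P.mkQ X
  rwa [Submodule.ker_mkQ] at this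

end Dimension

/-! ### Graded families of subspaces with commuting operators -/

section Family

variable {k : Type*} [Field k] {n : ℕ} {E : Type*} [AddCommGroup E] [Module k E]
  (μ : (Fin n → k) →ₗ[k] Module.End k E) (F : ℤ → Submodule k E)

/-- The components `N m ≤ F m` of a graded submodule. -/
structure IsFamily (N : ℤ → Submodule k E) : Prop where
  le : ∀ m, N m ≤ F m
  map_mem : ∀ m w, ∀ v ∈ N m, μ w v ∈ N (m + 1)

/-- The components of `N + wF`. -/
def addMap (N : ℤ → Submodule k E) (w : Fin n → k) (m : ℤ) : Submodule k E :=
  N m ⊔ (F (m - 1)).map (μ w)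

/-- The components of `N : w`. -/
def colon (N : ℤ → Submodule k E) (w : Fin n → k) (m : ℤ) : Submodule k E :=
  F m ⊓ (N (m + 1)).comap (μ w)

/-- The vectors `w` with `wF ⊆ N`. -/
def killed (N : ℤ → Submodule k E) : Submodule k (Fin n → k) where
  carrier := {w | ∀ m, ∀ v ∈ F m, μ w v ∈ N (m + 1)}
  zero_mem' := by simp
  add_mem' := fun {w w'} hw hw' m v hv => by
    rw [map_add, LinearMap.add_apply]
    exact add_mem (hw m v hv) (hw' m v hv)
  smul_mem' := fun c w hw m v hv => by
    rw [map_smul, LinearMap.smul_apply]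
    exact Submodule.smul_mem _ _ (hw m v hv)

/-- The codimension of `N m` in `F m`. -/
noncomputable def codim (N : ℤ → Submodule k E) (m : ℤ) : ℕ :=
  finrank k (F m) - finrank k (N m)

/-- The operators `μ w` behave like the multiplications by linear forms on a graded free module with
generators in the degrees `f i`. -/
structure IsFreeLike {r : ℕ} (f : Fin r → ℤ) (m₀ : ℤ) : Prop where
  comm : ∀ w w' v, μ w (μ w' v) = μ w' (μ w v)
  family : IsFamily μ F F
  finite : ∀ m, FiniteDimensional k (F m)
  eq_bot : ∀ m < m₀, F m = ⊥
  -- `totalDim 0 f m` is the number of generators of degree `m`: modulo the image of all linear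
  -- forms, nothing else survives in degree `m`.
  finrank_le : ∀ m (P : Submodule k E), P ≤ F m → (∀ w, ∀ v ∈ F (m - 1), μ w v ∈ P) →
    finrank k (F m) ≤ finrank k P + totalDim 0 f m

variable {μ F} {r : ℕ} {f : Fin r → ℤ} {m₀ : ℤ} {N : ℤ → Submodule k E}

theorem IsFamily.addMap (hF : IsFreeLike μ F f m₀) (hN : IsFamily μ F N) (w : Fin n → k) :
    IsFamily μ F (addMap μ F N w) where
  le m := sup_le (hN.le m) <| Submodule.map_le_iff_le_comap.mpr fun v hv => by
    have := hF.family.map_mem _ w v hv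
    rwa [sub_add_cancel] at this
  map_mem m w' v hv := by
    obtain ⟨x, hx, _, ⟨y, hy, rfl⟩, rfl⟩ := Submodule.mem_sup.mp hv
    rw [map_add, hF.comm]
    refine Submodule.add_mem_sup (hN.map_mem m w' x hx) ⟨μ w' y, ?_, rfl⟩
    have := hF.family.map_mem _ w' y hy
    rwa [sub_add_cancel, ← add_sub_cancel_right m 1] at this

theorem IsFamily.colon (hF : IsFreeLike μ F f m₀) (hN : IsFamily μ F N) (w : Fin n → k) :
    IsFamily μ F (colon μ F N w) where
  le _ := inf_le_left
  map_mem m w' v hv := ⟨hF.family.map_mem m w' v hv.1, by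
    rw [SetLike.mem_coe, Submodule.mem_comap, hF.comm]
    exact hN.map_mem (m + 1) w' _ hv.2⟩

theorem mem_killed {w : Fin n → k} :
    w ∈ killed μ F N ↔ ∀ m, ∀ v ∈ F m, μ w v ∈ N (m + 1) := Iff.rfl

theorem killed_le_killed_colon (hF : IsFreeLike μ F f m₀) (hN : IsFamily μ F N) (w : Fin n → k) :
    killed μ F N ≤ killed μ F (colon μ F N w) := fun w' hw' m v hv =>
  ⟨hF.family.map_mem m w' v hv, hN.map_mem (m + 1) w _ (hw' m v hv)⟩

/-- The codimension of `killed` plays the role of the number of variables; dividing by a form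
outside it uses up at least one variable. -/
theorem finrank_killed_lt_finrank_killed_addMap {w : Fin n → k} (hw : w ∉ killed μ F N) :
    finrank k (killed μ F N) < finrank k (killed μ F (addMap μ F N w)) := by
  refine Submodule.finrank_lt_finrank_of_lt (lt_of_le_of_ne ?_ fun h => hw ?_)
  · exact fun w' hw' m v hv => Submodule.mem_sup_left (hw' m v hv)
  · rw [h]
    exact fun m v hv => Submodule.mem_sup_right ⟨v, by rwa [add_sub_cancel_right], rfl⟩

/-! ### Codimensions of `N`, `N : w` and `N + wF`, and the restriction theorem for families -/

theorem codim_of_lt (hF : IsFreeLike μ F f m₀) (N : ℤ → Submodule k E) {m : ℤ} (hm : m < m₀) :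
    codim F N m = 0 := by
  rw [codim, hF.eq_bot m hm, finrank_bot, Nat.zero_sub]

theorem codim_addMap_le (hF : IsFreeLike μ F f m₀) (hN : IsFamily μ F N) (w : Fin n → k) (m : ℤ) :
    codim F (addMap μ F N w) m ≤ codim F N m := by
  have := hF.finite m
  have := Submodule.finrank_mono (hN.le m)
  have := Submodule.finiteDimensional_of_le ((hN.addMap hF w).le m)
  have : finrank k (N m) ≤ finrank k (addMap μ F N w m) := Submodule.finrank_mono le_sup_left
  rw [codim, codim]
  omega

/-- The exact sequence `0 → (F/(N : w))(-1) → F/N → F/(N + wF) → 0` in degree `m`. -/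
theorem codim_eq (hF : IsFreeLike μ F f m₀) (hN : IsFamily μ F N) (w : Fin n → k) (m : ℤ) :
    codim F N m = codim F (colon μ F N w) (m - 1) + codim F (addMap μ F N w) m := by
  have := hF.finite m
  have := hF.finite (m - 1)
  have := Submodule.finiteDimensional_of_le (hN.le m)
  have h1 := Submodule.finrank_mono (hN.le m)
  have h2 := Submodule.finrank_mono ((hN.addMap hF w).le m)
  have h3 := Submodule.finrank_mono ((hN.colon hF w).le (m - 1))
  have h4 := finrank_sup_map_add_finrank_inf_comap (μ w) (N m) (F (m - 1))
  have h5 : colon μ F N w (m - 1) = F (m - 1) ⊓ (N m).comap (μ w) := by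
    rw [colon, sub_add_cancel]
  rw [h5] at h3
  rw [codim, codim, codim, h5, addMap] at *
  omega

/-- The exact sequence for `N + w'F` and the form `w`, together with `(N : w) + w'F ⊆ (N + w'F) :
w`. The inclusion may be strict, hence only an inequality. -/
theorem codim_addMap_le_add (hF : IsFreeLike μ F f m₀) (hN : IsFamily μ F N) (w w' : Fin n → k)
    (m : ℤ) : codim F (addMap μ F N w') m ≤ codim F (addMap μ F (colon μ F N w) w') (m - 1)
      + codim F (addMap μ F (addMap μ F N w) w') m := by
  have := hF.finite m
  have := hF.finite (m - 1)
  have := Submodule.finiteDimensional_of_le ((hN.addMap hF w').le m)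
  have h1 := Submodule.finrank_mono ((hN.addMap hF w').le m)
  have h2 := Submodule.finrank_mono (((hN.addMap hF w).addMap hF w').le m)
  have h3 := Submodule.finrank_mono (((hN.colon hF w).addMap hF w').le (m - 1))
  have h4 := finrank_sup_map_add_finrank_inf_comap (μ w) (addMap μ F N w' m) (F (m - 1))
  have h5 : addMap μ F N w' m ⊔ (F (m - 1)).map (μ w)
      = addMap μ F (addMap μ F N w) w' m := by
    rw [addMap, addMap, addMap, sup_right_comm]
  have h6 : addMap μ F (colon μ F N w) w' (m - 1)
      ≤ F (m - 1) ⊓ (addMap μ F N w' m).comap (μ w) := by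
    refine le_inf (((hN.colon hF w).addMap hF w').le (m - 1)) (sup_le ?_ ?_)
    · intro v hv
      have := hv.2
      rw [sub_add_cancel] at this
      exact Submodule.mem_sup_left this
    · rintro _ ⟨v, hv, rfl⟩
      rw [Submodule.mem_comap, hF.comm]
      refine Submodule.mem_sup_right ⟨μ w v, ?_, rfl⟩
      have := hF.family.map_mem _ w v hv
      rwa [sub_add_cancel] at this
  have h7 := Submodule.finrank_mono h6
  rw [h5] at h4
  rw [codim, codim, codim]
  omega

/-- The codimension is smallest where the rank of `w : F_{m-1} → E/N_m` is largest. Ranks are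
bounded, so the maximum is attained at some `w₀`, and semicontinuity spreads it to generic `w`. -/
theorem generic_codim_addMap_le (hF : IsFreeLike μ F f m₀) (hN : IsFamily μ F N) (m : ℤ) :
    Generic fun w => ∀ w', codim F (addMap μ F N w) m ≤ codim F (addMap μ F N w') m := by
  have := hF.finite m
  have := hF.finite (m - 1)
  have hfin := fun w => Submodule.finiteDimensional_of_le ((hN.addMap hF w).le m)
  have hle := fun w => Submodule.finrank_mono ((hN.addMap hF w).le m)
  let φ : (Fin n → k) →ₗ[k] F (m - 1) →ₗ[k] E ⧸ N m :=
    { toFun := fun w => (N m).mkQ ∘ₗ μ w ∘ₗ (F (m - 1)).subtype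
      map_add' := fun w w' => by ext v; simp
      map_smul' := fun c w => by ext v; simp }
  have hφ : ∀ w, finrank k (LinearMap.range (φ w)) + finrank k (N m)
      = finrank k (addMap μ F N w m) := by
    intro w
    have h1 : LinearMap.range (φ w) = (addMap μ F N w m).map (N m).mkQ := by
      simp only [φ, LinearMap.coe_mk, AddHom.coe_mk, LinearMap.range_comp, Submodule.range_subtype]
      rw [addMap, Submodule.map_sup, (N m).mkQ_map_self, bot_sup_eq]
    have h2 := finrank_map_mkQ_add (N m) (addMap μ F N w m)
    rwa [← h1, inf_eq_right.mpr (show N m ≤ addMap μ F N w m from le_sup_left)] at h2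
  obtain ⟨w₀, hw₀⟩ : ∃ w₀, ∀ w, finrank k (addMap μ F N w m) ≤ finrank k (addMap μ F N w₀ m) := by
    have hb : BddAbove (Set.range fun w => finrank k (addMap μ F N w m)) :=
      ⟨finrank k (F m), by rintro _ ⟨w, rfl⟩; exact hle w⟩
    obtain ⟨w₀, hw₀⟩ := Nat.sSup_mem (Set.range_nonempty _) hb
    exact ⟨w₀, fun w => by simp only at hw₀; rw [hw₀]; exact le_csSup hb ⟨w, rfl⟩⟩
  refine (generic_finrank_range_le φ w₀).mono fun w hw w' => ?_
  have h1 := hφ w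
  have h2 := hφ w₀
  have h3 := hw₀ w'
  rw [codim, codim]
  omega

/-- `F/N` is no larger than a free module in `s` variables with the same generator degrees. The
bound `j` on the degree above `m₀` makes a double induction possible: `N + wF` lowers `s`, `N : w`
lowers `j`, and `totalDim_succ` matches `codim_eq`. -/
theorem codim_le_totalDim (hF : IsFreeLike μ F f m₀) (s j : ℕ) {N : ℤ → Submodule k E}
    (hN : IsFamily μ F N) (hs : n ≤ finrank k (killed μ F N) + s) {m : ℤ} (hm : m < m₀ + j) :
    codim F N m ≤ totalDim s f m := by
  induction s generalizing j N m with
  | zero =>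
    have htop : killed μ F N = ⊤ := Submodule.eq_top_of_finrank_eq <| le_antisymm
      (Submodule.finrank_le _) (by simpa using hs)
    have := hF.finrank_le m (N m) (hN.le m) fun w v hv => by
      have := mem_killed.mp (htop ▸ Submodule.mem_top (x := w)) _ v hv
      rwa [sub_add_cancel] at this
    rw [codim]
    omega
  | succ s ih =>
    induction j generalizing N m with
    | zero => rw [codim_of_lt hF N (by simpa using hm)]; exact Nat.zero_le _
    | succ j ihj =>
      by_cases htop : killed μ F N = ⊤
      · exact (ih (j + 1) hN (by rw [htop, finrank_top]; simp) hm).trans (totalDim_mono f m (Nat.le_succ s))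
      · obtain ⟨w, hw⟩ : ∃ w, w ∉ killed μ F N := by
          by_contra! h
          exact htop (eq_top_iff.mpr fun w _ => h w)
        have h1 := finrank_killed_lt_finrank_killed_addMap hw
        have h2 := Submodule.finrank_mono (killed_le_killed_colon hF hN w)
        have h3 := ih (j + 1) (hN.addMap hF w) (by omega) hm
        have h4 := ihj (hN.colon hF w) (by omega) (m := m - 1) (by push_cast at hm; omega)
        rw [codim_eq hF hN w, totalDim_succ]
        omega

/-- The restriction theorem in a single degree. -/
theorem generic_codim_addMap_le_moduleLower [Infinite k] (hf : Monotone f)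
    (hF : IsFreeLike μ F f m₀) (s j : ℕ) {N : ℤ → Submodule k E}
    (hN : IsFamily μ F N) (hs : n ≤ finrank k (killed μ F N) + s) {m : ℤ} (hm : m < m₀ + j) :
    Generic fun w => codim F (addMap μ F N w) m ≤ moduleLower s f m (codim F N m) := by
  -- If every form annihilates `F/N`, only generators of degree `m` survive, and on their number the
  -- lowering is the identity.
  have hkill : ∀ (s : ℕ) {N : ℤ → Submodule k E} {m : ℤ}, IsFamily μ F N → m < m₀ + j →
      killed μ F N = ⊤ →
      Generic fun w => codim F (addMap μ F N w) m ≤ moduleLower s f m (codim F N m) := by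
    intro s N m hN hm htop
    have := codim_le_totalDim hF 0 j hN (by rw [htop, finrank_top]; simp) hm
    rw [moduleLower_of_le s hf m this]
    exact .of_forall fun w => codim_addMap_le hF hN w m
  induction s generalizing j N m with
  | zero =>
    exact hkill 0 hN hm <| Submodule.eq_top_of_finrank_eq <| le_antisymm
      (Submodule.finrank_le _) (by simpa using hs)
  | succ s ih =>
    induction j generalizing N m with
    | zero =>
      refine .of_forall fun w => ?_
      rw [codim_of_lt hF _ (by simpa using hm)]
      exact Nat.zero_le _
    | succ j ihj =>
      by_cases htop : killed μ F N = ⊤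
      · exact hkill _ hN hm htop
      refine ((generic_codim_addMap_le hF hN m).and (generic_notMem htop)).mono ?_
      rintro w ⟨hmin, hw⟩
      have hk1 := finrank_killed_lt_finrank_killed_addMap hw
      have hk2 := Submodule.finrank_mono (killed_le_killed_colon hF hN w)
      have hm' : m - 1 < m₀ + j := by push_cast at hm; omega
      have ha := codim_le_totalDim hF (s + 1) _ hN hs hm
      have hc := codim_le_totalDim hF s _ (hN.addMap hF w) (by omega) hm
      have hac := codim_le_totalDim hF (s + 1) _ (hN.colon hF w) (by omega) hm'
      have hca := codim_addMap_le hF hN w m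
      have heq := codim_eq hF hN w m
      -- With a single variable left, `c` is at most the number of generators of degree `m`, so it
      -- is its own lowering and monotonicity suffices; `le_moduleLower` needs two variables.
      rcases Nat.eq_zero_or_pos s with rfl | hs0
      · have h1 := moduleLower_mono (0 + 1) f m hca ha
        rwa [moduleLower_of_le _ hf m hc] at h1
      · obtain ⟨s, rfl⟩ : ∃ t, s = t + 1 := ⟨s - 1, by omega⟩
        -- With `w` fixed, a second form is chosen generic both for `N + wF` (one variable fewer)
        -- and for `N : w` (one degree lower). Minimality of `w` then bounds `c` by the codimension
        -- for `w'`.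
        obtain ⟨w', h1, h2⟩ := ((ih (j + 1) (hN.addMap hF w) (by omega) hm hkill).and
          (ihj (hN.colon hF w) (by omega) hm' fun s N m hN hm => hkill s hN
            (by push_cast; omega))).exists
        have hsub : codim F N m - codim F (addMap μ F N w) m
          = codim F (colon μ F N w) (m - 1) := by omega
        refine le_moduleLower hf ha hca hc (hsub ▸ hac) ?_
        rw [hsub]
        exact (hmin w').trans ((codim_addMap_le_add hF hN w w' m).trans (add_le_add h2 h1))

end Family

end GreenModule

namespace GreenModule

open Finset

/-! ### Lower sets of monomials in the lexicographic order -/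

theorem degree_eq_zero_add_tail {n : ℕ} (u : Fin (n + 1) →₀ ℕ) :
    u.degree = u 0 + u.tail.degree := by
  simp [Finsupp.degree_eq_sum, Fin.sum_univ_succ, Finsupp.tail_apply]

theorem toLex_cons_lt {n : ℕ} {a : ℕ} {u v : Fin n →₀ ℕ} (h : toLex u < toLex v) :
    toLex (u.cons a) < toLex (v.cons a) := by
  rw [Finsupp.Lex.lt_iff] at *
  obtain ⟨i, h1, h2⟩ := h
  refine ⟨i.succ, fun j hj => ?_, by simpa using h2⟩
  cases j using Fin.cases with
  | zero => simp
  | succ j => simpa using h1 j (by simpa using hj)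

theorem toLex_lt_of_zero_lt {n : ℕ} {u v : Fin (n + 1) →₀ ℕ} (h : u 0 < v 0) :
    toLex u < toLex v :=
  Finsupp.Lex.lt_iff.mpr ⟨0, fun j hj => absurd hj (by simp), h⟩

/-- The monomials of degree `d`. -/
def monomialsOfDegree (n d : ℕ) : Finset (Fin n →₀ ℕ) := finsuppAntidiag univ d

theorem mem_monomialsOfDegree {n d : ℕ} {u : Fin n →₀ ℕ} :
    u ∈ monomialsOfDegree n d ↔ u.degree = d := by
  simp [monomialsOfDegree, Finsupp.degree_eq_sum]

theorem card_monomialsOfDegree (n d : ℕ) : (monomialsOfDegree n d).card = (n + d - 1).choose d := by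
  rw [monomialsOfDegree, card_finsuppAntidiag_nat_eq_choose, card_univ, Fintype.card_fin]

/-- In a lexicographically lower set of `a` monomials of degree `d`, the number of monomials not
divisible by the last variable is `a_⟨d⟩`. -/
theorem card_filter_last_eq_zero {n d : ℕ} {A : Finset (Fin (n + 1) →₀ ℕ)}
    (hdeg : ∀ u ∈ A, u.degree = d)
    (hlow : ∀ u ∈ A, ∀ v, v.degree = d → toLex v < toLex u → v ∈ A) :
    (A.filter fun u => u (Fin.last n) = 0).card = macaulayLower d A.card := by
  classical
  induction n generalizing d with
  | zero =>
    have hA : ∀ u ∈ A, u 0 = d := fun u hu => by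
      simpa [Finsupp.degree_eq_sum] using hdeg u hu
    have hA1 : A.card ≤ 1 := card_le_one.mpr fun u hu v hv => by
      ext i
      rw [Fin.fin_one_eq_zero i, hA u hu, hA v hv]
    cases d with
    | zero => exact congrArg card (filter_true_of_mem hA)
    | succ d =>
      rw [filter_false_of_mem fun u hu => by
        have h1 : u (Fin.last 0) = d + 1 := hA u hu
        omega, card_empty]
      interval_cases A.card
      · rw [macaulayLower_zero]
      · rw [macaulayLower_one]
  | succ n ihn =>
    -- Monomials free of the first variable form a lower set in one variable fewer, where the outer
    -- induction applies.
    have hzero : ∀ (d : ℕ) (A : Finset (Fin (n + 2) →₀ ℕ)), (∀ u ∈ A, u.degree = d) →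
        (∀ u ∈ A, ∀ v, v.degree = d → toLex v < toLex u → v ∈ A) →
        ((A.filter fun u => u 0 = 0).filter fun u => u (Fin.last (n + 1)) = 0).card
          = macaulayLower d (A.filter fun u => u 0 = 0).card := by
      intro d A hdeg hlow
      have hinj : Set.InjOn Finsupp.tail ((A.filter fun u => u 0 = 0 : Finset _) : Set (Fin (n + 2) →₀ ℕ)) := by
        intro u hu v hv huv
        rw [← Finsupp.cons_tail u, ← Finsupp.cons_tail v, huv, (mem_filter.mp hu).2,
          (mem_filter.mp hv).2]
      have h := ihn (d := d) (A := (A.filter fun u => u 0 = 0).image Finsupp.tail) ?_ ?_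
      · rw [card_image_of_injOn (by simpa using hinj), filter_image, card_image_of_injOn
          (fun u hu v hv => hinj (by simpa using (mem_filter.mp hu).1)
            (by simpa using (mem_filter.mp hv).1))] at h
        rw [← h]
        congr 1
      · intro u hu
        obtain ⟨v, hv, rfl⟩ := mem_image.mp hu
        obtain ⟨hv, hv0⟩ := mem_filter.mp hv
        rw [← hdeg v hv, degree_eq_zero_add_tail v, hv0, zero_add]
      · intro u hu w hw hwu
        obtain ⟨v, hv, rfl⟩ := mem_image.mp hu
        obtain ⟨hv, hv0⟩ := mem_filter.mp hv
        refine mem_image.mpr ⟨w.cons 0, mem_filter.mpr ⟨hlow v hv _ ?_ ?_, rfl⟩,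
          Finsupp.tail_cons 0 w⟩
        · rw [degree_eq_zero_add_tail, Finsupp.tail_cons, hw]
          simp
        · have := toLex_cons_lt (a := 0) hwu
          rwa [← hv0, Finsupp.cons_tail, hv0] at this
    induction d generalizing A with
    | zero =>
      have := hzero 0 A hdeg hlow
      have h0 : ∀ u ∈ A, u 0 = 0 := fun u hu => by
        have := hdeg u hu
        rw [degree_eq_zero_add_tail] at this
        omega
      rwa [filter_true_of_mem h0] at this
    | succ d ihd =>
      -- Monomials free of the first variable are the smallest. Once `A` has a monomial divisible by
      -- it, `A` contains all of the free ones, `C(t, d+1)` in number with `t = n + d + 1`. Dividing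
      -- the others by that variable leaves a lower set of at most `C(t, d)` monomials of degree
      -- `d`, so `macaulayLower_choose_add` applies.
      by_cases hA : ∀ u ∈ A, u 0 = 0
      · have := hzero _ A hdeg hlow
        rwa [filter_true_of_mem hA] at this
      push Not at hA
      obtain ⟨u₀, hu₀, hu₀0⟩ := hA
      set e : Fin (n + 2) →₀ ℕ := Finsupp.single 0 1 with he
      have hinj : Set.InjOn (· - e) ((A.filter fun u => ¬ u 0 = 0 : Finset _) : Set (Fin (n + 2) →₀ ℕ)) := by
        intro u hu v hv huv
        have hle : ∀ w : Fin (n + 2) →₀ ℕ, ¬ w 0 = 0 → e ≤ w := fun w hw => by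
          rw [he, Finsupp.single_le_iff]
          omega
        rw [← tsub_add_cancel_of_le (hle u (mem_filter.mp hu).2),
          ← tsub_add_cancel_of_le (hle v (mem_filter.mp hv).2)]
        exact congrArg (· + e) huv
      have hadd : ∀ u : Fin (n + 2) →₀ ℕ, ¬ u 0 = 0 → u - e + e = u := fun u hu =>
        tsub_add_cancel_of_le (by rw [he, Finsupp.single_le_iff]; omega)
      have h1 := ihd (A := (A.filter fun u => ¬ u 0 = 0).image (· - e)) ?_ ?_
      · rw [card_image_of_injOn (by simpa using hinj), filter_image, card_image_of_injOn
          (fun u hu v hv => hinj (by simpa using (mem_filter.mp hu).1)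
            (by simpa using (mem_filter.mp hv).1))] at h1
        have hlast : ∀ u : Fin (n + 2) →₀ ℕ, (u - e) (Fin.last (n + 1)) = u (Fin.last (n + 1)) := by
          intro u
          rw [Finsupp.tsub_apply, he, Finsupp.single_eq_of_ne (Fin.last_pos.ne'), Nat.sub_zero]
        simp only [hlast] at h1
        have h0 := hzero _ A hdeg hlow
        have hfull : (A.filter fun u => u 0 = 0).card = (n + (d + 1)).choose (d + 1) := by
          have hcard := card_monomialsOfDegree (n + 1) (d + 1)
          rw [show n + 1 + (d + 1) - 1 = n + (d + 1) by omega] at hcard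
          rw [← hcard]
          symm
          refine card_bij (fun u _ => u.cons 0) ?_ ?_ ?_
          · intro u hu
            rw [mem_monomialsOfDegree] at hu
            refine mem_filter.mpr ⟨hlow u₀ hu₀ _ ?_ (toLex_lt_of_zero_lt ?_), rfl⟩
            · rw [degree_eq_zero_add_tail, Finsupp.tail_cons, hu]
              simp
            · rw [Finsupp.cons_zero]
              omega
          · intro u _ v _ huv
            exact Finsupp.cons_right_injective 0 huv
          · intro u hu
            obtain ⟨hu, hu0⟩ := mem_filter.mp hu
            refine ⟨u.tail, ?_, ?_⟩
            · rw [mem_monomialsOfDegree, ← hdeg u hu, degree_eq_zero_add_tail u, hu0, zero_add]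
            · rw [← hu0, Finsupp.cons_tail]
        have hA1 : (A.filter fun u => ¬ u 0 = 0).card ≤ (n + (d + 1)).choose d := by
          have hcard := card_monomialsOfDegree (n + 2) d
          rw [show n + 2 + d - 1 = n + (d + 1) by omega] at hcard
          rw [← hcard, ← card_image_of_injOn (f := (· - e)) (by simpa using hinj)]
          refine card_le_card fun u hu => ?_
          obtain ⟨v, hv, rfl⟩ := mem_image.mp hu
          obtain ⟨hv, hv0⟩ := mem_filter.mp hv
          have h2 := hdeg v hv
          rw [← hadd v hv0, map_add, he, Finsupp.degree_single] at h2
          rw [mem_monomialsOfDegree]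
          exact Nat.succ_injective h2
        have hs1 := card_filter_add_card_filter_not (s := A) fun u => u 0 = 0
        have hs2 := card_filter_add_card_filter_not
          (s := A.filter fun u => u (Fin.last (n + 1)) = 0) fun u => u 0 = 0
        rw [filter_comm, filter_comm _ (fun u : Fin (n + 2) →₀ ℕ => ¬ u 0 = 0)] at hs2
        rw [← hs2, h0, h1, ← hs1, hfull, macaulayLower_choose_add (by omega) hA1,
          macaulayLower_choose (by omega)]
      · intro u hu
        obtain ⟨v, hv, rfl⟩ := mem_image.mp hu
        obtain ⟨hv, hv0⟩ := mem_filter.mp hv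
        have h2 := hdeg v hv
        rw [← hadd v hv0, map_add, he, Finsupp.degree_single] at h2
        exact Nat.succ_injective h2
      · intro u hu w hw hwu
        obtain ⟨v, hv, rfl⟩ := mem_image.mp hu
        obtain ⟨hv, hv0⟩ := mem_filter.mp hv
        refine mem_image.mpr ⟨w + e, mem_filter.mpr ⟨hlow v hv _ ?_ ?_, ?_⟩, ?_⟩
        · rw [map_add, hw, he, Finsupp.degree_single]
        · have := add_lt_add_left hwu (toLex e)
          rwa [← toLex_add, ← toLex_add, hadd v hv0] at this
        · simp [he]
        · exact add_tsub_cancel_right w e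

/-! ### Lower sets of monomials of the free module -/

section Module

variable {n r : ℕ}

/-- The monomials of degree `m` of the free module. -/
noncomputable def moduleMonomials (n : ℕ) (f : Fin r → ℤ) (m : ℤ) :
    Finset (Fin r × (Fin n →₀ ℕ)) :=
  (univ.sigma fun i => if f i ≤ m then monomialsOfDegree n (m - f i).toNat else ∅).map
    (Equiv.sigmaEquivProd _ _).toEmbedding

theorem mem_moduleMonomials {f : Fin r → ℤ} {m : ℤ} {u : Fin r × (Fin n →₀ ℕ)} :
    u ∈ moduleMonomials n f m ↔ monDegree f u = m := by
  obtain ⟨i, u⟩ := u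
  rw [moduleMonomials, mem_map_equiv, mem_sigma, monDegree]
  simp only [Equiv.sigmaEquivProd_symm_apply, mem_univ, true_and]
  split_ifs with h
  · rw [mem_monomialsOfDegree]
    omega
  · simp only [notMem_empty, false_iff]
    omega

theorem card_filter_fst_moduleMonomials (f : Fin r → ℤ) (m : ℤ) (i : Fin r) :
    ((moduleMonomials n f m).filter fun u => u.1 = i).card = polyDim n (m - f i) := by
  rcases lt_or_ge m (f i) with h | h
  · rw [polyDim_of_neg (by omega), card_eq_zero, filter_eq_empty_iff]
    intro u hu hi
    rw [mem_moduleMonomials, monDegree, hi] at hu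
    omega
  · rw [polyDim, if_pos (by omega), ← card_monomialsOfDegree]
    refine card_bij (fun u _ => u.2) ?_ ?_ ?_
    · intro u hu
      obtain ⟨hu, hi⟩ := mem_filter.mp hu
      rw [mem_moduleMonomials, monDegree, hi] at hu
      rw [mem_monomialsOfDegree]
      omega
    · intro u hu v hv huv
      exact Prod.ext ((mem_filter.mp hu).2.trans (mem_filter.mp hv).2.symm) huv
    · intro u hu
      rw [mem_monomialsOfDegree] at hu
      refine ⟨(i, u), mem_filter.mpr ⟨?_, rfl⟩, rfl⟩
      rw [mem_moduleMonomials, monDegree]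
      simp only
      omega

theorem card_moduleMonomials (f : Fin r → ℤ) (m : ℤ) :
    (moduleMonomials n f m).card = totalDim n f m := by
  rw [card_eq_sum_card_fiberwise (f := Prod.fst) (t := univ) (by simp), totalDim]
  exact sum_congr rfl fun i _ => card_filter_fst_moduleMonomials f m i

/-- Since `e_1 > e_2 > ⋯`, a lower set fills the summands from the last one; this identifies its
fibres with the shares in `moduleLower_eq_sum`. -/
theorem eq_min_of_full {N x : Fin r → ℕ} (hx : ∀ i, x i ≤ N i)
    (h : ∀ i, x i ≠ 0 → ∀ l, i < l → x l = N l) (i : Fin r) :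
    x i = min (N i) (∑ l, x l - ∑ l ∈ Ioi i, N l) := by
  have hu : ∑ l, x l = ∑ l ∈ Iio i, x l + (x i + ∑ l ∈ Ioi i, x l) := by
    rw [← sum_Ici_eq, ← sum_union]
    · congr 1
      ext l
      simp only [mem_univ, mem_union, mem_Iio, mem_Ici, true_iff]
      exact lt_or_ge l i
    · rw [disjoint_left]
      intro l hl hl'
      simp only [mem_Iio, mem_Ici] at hl hl'
      exact absurd hl (not_lt.mpr hl')
  have hle : ∑ l ∈ Ioi i, x l ≤ ∑ l ∈ Ioi i, N l := sum_le_sum fun l _ => hx l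
  have hi := hx i
  have hfull : x i ≠ 0 → ∑ l ∈ Ioi i, x l = ∑ l ∈ Ioi i, N l := fun h0 =>
    sum_congr rfl fun l hl => h i h0 l (mem_Ioi.mp hl)
  by_cases hz : ∑ l ∈ Iio i, x l = 0
  · by_cases h0 : x i = 0
    · omega
    · have := hfull h0
      omega
  · obtain ⟨l, hl, hl0⟩ := exists_ne_zero_of_sum_ne_zero hz
    have h1 := h l hl0 i (mem_Iio.mp hl)
    have h2 : ∑ l ∈ Ioi i, x l = ∑ l ∈ Ioi i, N l :=
      sum_congr rfl fun l' hl' => h l hl0 l' ((mem_Iio.mp hl).trans (mem_Ioi.mp hl'))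
    omega

/-- In a lower set of `a` monomials of degree `m` of the free module, the number of monomials not
divisible by the last variable is `a_{m,r}`. -/
theorem card_filter_last_eq_moduleLower {f : Fin r → ℤ} {m : ℤ}
    {B : Finset (Fin r × (Fin (n + 1) →₀ ℕ))} (hdeg : ∀ u ∈ B, monDegree f u = m)
    (hlow : ∀ u ∈ B, ∀ v, monDegree f v = m → MonGT u v → v ∈ B) :
    (B.filter fun u => u.2 (Fin.last n) = 0).card = moduleLower (n + 1) f m B.card := by
  classical
  have hsub : B ⊆ moduleMonomials (n + 1) f m := fun u hu =>
    mem_moduleMonomials.mpr (hdeg u hu)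
  have hsum : B.card = ∑ i, (B.filter fun u => u.1 = i).card :=
    card_eq_sum_card_fiberwise (by simp)
  have hmin := eq_min_of_full (x := fun i => (B.filter fun u => u.1 = i).card)
    (N := fun i => polyDim (n + 1) (m - f i))
    (fun i => by
      rw [← card_filter_fst_moduleMonomials]
      exact card_le_card (filter_subset_filter _ hsub))
    (fun i hi l hil => by
      rw [← card_filter_fst_moduleMonomials]
      congr 1
      obtain ⟨u, hu⟩ := card_ne_zero.mp hi
      obtain ⟨hu', rfl⟩ := mem_filter.mp hu
      refine (filter_subset_filter _ hsub).antisymm fun v hv => ?_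
      obtain ⟨hv', rfl⟩ := mem_filter.mp hv
      exact mem_filter.mpr ⟨hlow u hu' v (mem_moduleMonomials.mp hv') (Or.inl hil), rfl⟩)
  rw [moduleLower_eq_sum _ _ _ (by rw [← card_moduleMonomials]; exact card_le_card hsub),
    card_eq_sum_card_fiberwise (f := Prod.fst) (t := univ) (by simp)]
  refine sum_congr rfl fun i _ => ?_
  have hi := hmin i
  rw [hsum, ← hi, filter_comm]
  have hinj : Set.InjOn Prod.snd
      ((B.filter fun u => u.1 = i : Finset _) : Set (Fin r × (Fin (n + 1) →₀ ℕ))) := fun u hu v hv huv =>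
    Prod.ext ((mem_filter.mp hu).2.trans (mem_filter.mp hv).2.symm) huv
  have h := card_filter_last_eq_zero (d := (m - f i).toNat)
    (A := (B.filter fun u => u.1 = i).image Prod.snd) ?_ ?_
  · rwa [card_image_of_injOn (by simpa using hinj), filter_image, card_image_of_injOn
      (fun u hu v hv => hinj (by simpa using (mem_filter.mp hu).1)
        (by simpa using (mem_filter.mp hv).1))] at h
  · intro u hu
    obtain ⟨v, hv, rfl⟩ := mem_image.mp hu
    obtain ⟨hv', rfl⟩ := mem_filter.mp hv
    have := hdeg v hv'
    rw [monDegree] at this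
    omega
  · intro u hu w hw hwu
    obtain ⟨v, hv, rfl⟩ := mem_image.mp hu
    obtain ⟨hv', rfl⟩ := mem_filter.mp hv
    refine mem_image.mpr ⟨(v.1, w), mem_filter.mpr ⟨hlow v hv' _ ?_ (Or.inr ⟨rfl, hwu⟩), rfl⟩, rfl⟩
    have := hdeg v hv'
    rw [monDegree] at *
    simp only
    omega

end Module

end GreenModule

namespace GreenModule

open Module

/-! ### The monomial basis of the free module -/

section Monomials

variable {k : Type*} [Field k] {n r : ℕ}

/-- The monomial `x^a e_i` of the free module, for `u = (i, a)`. -/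
noncomputable def mon (k : Type*) [Field k] {n r : ℕ} (u : Fin r × (Fin n →₀ ℕ)) :
    FreeMod k n r :=
  Pi.single u.1 (MvPolynomial.monomial u.2 1)

/-- The monomial basis of the free module. -/
noncomputable def monBasis (k : Type*) [Field k] (n r : ℕ) :
    Basis (Fin r × (Fin n →₀ ℕ)) k (FreeMod k n r) :=
  (Pi.basis fun _ => MvPolynomial.basisMonomials (Fin n) k).reindex (Equiv.sigmaEquivProd _ _)

theorem monBasis_apply (u : Fin r × (Fin n →₀ ℕ)) : monBasis k n r u = mon k u := by
  rw [monBasis, Basis.reindex_apply, Pi.basis_apply, MvPolynomial.coe_basisMonomials]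
  rfl

theorem monBasis_repr (v : FreeMod k n r) (u : Fin r × (Fin n →₀ ℕ)) :
    (monBasis k n r).repr v u = (v u.1).coeff u.2 := by
  rw [monBasis, Basis.repr_reindex_apply, Pi.basis_repr]
  rfl

theorem linearIndependent_mon : LinearIndependent k (mon k : Fin r × (Fin n →₀ ℕ) → _) := by
  have := (monBasis k n r).linearIndependent
  rwa [show ⇑(monBasis k n r) = mon k from funext monBasis_apply] at this

theorem span_range_mon : Submodule.span k (Set.range (mon k : Fin r × (Fin n →₀ ℕ) → _)) = ⊤ := by
  have := (monBasis k n r).span_eq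
  rwa [show ⇑(monBasis k n r) = mon k from funext monBasis_apply] at this

theorem mem_span_range_mon (v : FreeMod k n r) :
    v ∈ Submodule.span k (Set.range (mon k : Fin r × (Fin n →₀ ℕ) → _)) := by
  rw [span_range_mon]
  exact Submodule.mem_top

theorem mem_piece_iff {f : Fin r → ℤ} {m : ℤ} {v : FreeMod k n r} :
    v ∈ piece k n f m ↔ ∀ i, ∀ a ∈ (v i).support, monDegree f (i, a) = m := Iff.rfl

theorem mon_mem_piece (f : Fin r → ℤ) (u : Fin r × (Fin n →₀ ℕ)) :
    mon k u ∈ piece k n f (monDegree f u) := by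
  classical
  rw [mem_piece_iff]
  intro i a ha
  rw [mon, Pi.single_apply] at ha
  split_ifs at ha with h
  · subst h
    rw [Finset.mem_singleton.mp (MvPolynomial.support_monomial_subset ha)]
  · simp at ha

theorem piece_eq_span (f : Fin r → ℤ) (m : ℤ) :
    piece k n f m = Submodule.span k (mon k '' (moduleMonomials n f m : Set _)) := by
  refine le_antisymm (fun v hv => ?_) (Submodule.span_le.mpr ?_)
  · rw [← (monBasis k n r).linearCombination_repr v, Finsupp.linearCombination_apply]
    refine Submodule.sum_mem _ fun u hu => Submodule.smul_mem _ _ (Submodule.subset_span ⟨u, ?_, ?_⟩)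
    · rw [Finsupp.mem_support_iff, monBasis_repr] at hu
      exact mem_moduleMonomials.mpr (hv u.1 u.2 (MvPolynomial.mem_support_iff.mpr hu))
    · rw [monBasis_apply]
  · rintro _ ⟨u, hu, rfl⟩
    rw [← mem_moduleMonomials.mp hu]
    exact mon_mem_piece f u

theorem finrank_span_mon (A : Finset (Fin r × (Fin n →₀ ℕ))) :
    finrank k (Submodule.span k (mon k '' (A : Set (Fin r × (Fin n →₀ ℕ))))) = A.card := by
  classical
  rw [← Finset.coe_image, finrank_span_finset_eq_card, Finset.card_image_of_injective _
    linearIndependent_mon.injective]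
  have := (linearIndependent_mon (k := k) (n := n) (r := r)).linearIndepOn_id
  refine this.mono ?_
  rw [Finset.coe_image]
  exact Set.image_subset_range _ _

theorem finrank_span_image_le {ι V : Type*} [AddCommGroup V] [Module k V] (A : Finset ι)
    (g : ι → V) : finrank k (Submodule.span k (g '' (A : Set ι))) ≤ A.card := by
  classical
  rw [← Finset.coe_image]
  exact (finrank_span_finset_le_card _).trans Finset.card_image_le

instance finiteDimensional_span_image {ι V : Type*} [AddCommGroup V] [Module k V] (A : Finset ι)
    (g : ι → V) : FiniteDimensional k (Submodule.span k (g '' (A : Set ι))) :=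
  FiniteDimensional.span_of_finite k (A.finite_toSet.image g)

instance finiteDimensional_piece (f : Fin r → ℤ) (m : ℤ) :
    FiniteDimensional k (piece k n f m) := by
  rw [piece_eq_span]
  infer_instance

theorem finrank_piece (f : Fin r → ℤ) (m : ℤ) : finrank k (piece k n f m) = totalDim n f m := by
  rw [piece_eq_span, finrank_span_mon, card_moduleMonomials]

/-! ### Projections onto the homogeneous components -/

/-- The projection onto the component of degree `m`. -/
noncomputable def proj (k : Type*) [Field k] (n : ℕ) {r : ℕ} (f : Fin r → ℤ) (m : ℤ) :
    FreeMod k n r →ₗ[k] FreeMod k n r :=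
  (monBasis k n r).constr k fun u => if monDegree f u = m then mon k u else 0

theorem proj_mon (f : Fin r → ℤ) (m : ℤ) (u : Fin r × (Fin n →₀ ℕ)) :
    proj k n f m (mon k u) = if monDegree f u = m then mon k u else 0 := by
  rw [← monBasis_apply, proj, Basis.constr_basis, monBasis_apply]

theorem proj_of_mem_piece {f : Fin r → ℤ} {m m' : ℤ} {v : FreeMod k n r}
    (hv : v ∈ piece k n f m') : proj k n f m v = if m' = m then v else 0 := by
  rw [piece_eq_span] at hv
  induction hv using Submodule.span_induction with
  | mem v hv =>
    obtain ⟨u, hu, rfl⟩ := hv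
    rw [proj_mon, mem_moduleMonomials.mp hu]
  | zero => simp
  | add v w _ _ hv hw => rw [map_add, hv, hw]; split_ifs <;> simp
  | smul c v _ hv => rw [map_smul, hv]; split_ifs <;> simp

theorem proj_mem_piece (f : Fin r → ℤ) (m : ℤ) (v : FreeMod k n r) :
    proj k n f m v ∈ piece k n f m := by
  have hv := mem_span_range_mon v
  induction hv using Submodule.span_induction with
  | mem v hv =>
    obtain ⟨u, rfl⟩ := hv
    rw [proj_mon]
    split_ifs with h
    · rw [← h]
      exact mon_mem_piece f u
    · exact zero_mem _
  | zero => simp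
  | add v w _ _ hv hw => rw [map_add]; exact add_mem hv hw
  | smul c v _ hv => rw [map_smul]; exact Submodule.smul_mem _ _ hv

/-! ### Multiplication by linear forms -/

theorem X_smul_mon (i : Fin n) (u : Fin r × (Fin n →₀ ℕ)) :
    (MvPolynomial.X i : Poly k n) • mon k u = mon k (u.1, u.2 + Finsupp.single i 1) := by
  rw [mon, mon, ← Pi.single_smul, smul_eq_mul, MvPolynomial.X, MvPolynomial.monomial_mul, one_mul,
    add_comm]

theorem linForm_smul_mon (c : Fin n → k) (u : Fin r × (Fin n →₀ ℕ)) :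
    linForm c • mon k u = ∑ i, c i • mon k (u.1, u.2 + Finsupp.single i 1) := by
  rw [linForm, Finset.sum_smul]
  refine Finset.sum_congr rfl fun i _ => ?_
  rw [mul_smul, X_smul_mon, ← MvPolynomial.algebraMap_eq, algebraMap_smul]

theorem monDegree_add_single (f : Fin r → ℤ) (u : Fin r × (Fin n →₀ ℕ)) (i : Fin n) :
    monDegree f (u.1, u.2 + Finsupp.single i 1) = monDegree f u + 1 := by
  rw [monDegree, monDegree, map_add, Finsupp.degree_single]
  push_cast
  ring

theorem linForm_smul_mem_piece {f : Fin r → ℤ} {m : ℤ} (c : Fin n → k) {v : FreeMod k n r}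
    (hv : v ∈ piece k n f m) : linForm c • v ∈ piece k n f (m + 1) := by
  rw [piece_eq_span] at hv
  induction hv using Submodule.span_induction with
  | mem v hv =>
    obtain ⟨u, hu, rfl⟩ := hv
    rw [linForm_smul_mon, ← mem_moduleMonomials.mp hu]
    refine sum_mem fun i _ => Submodule.smul_mem _ _ ?_
    rw [← monDegree_add_single f u i]
    exact mon_mem_piece f _
  | zero => simp
  | add v w _ _ hv hw => rw [smul_add]; exact add_mem hv hw
  | smul a v _ hv => rw [smul_comm]; exact Submodule.smul_mem _ _ hv

theorem proj_linForm_smul (f : Fin r → ℤ) (m : ℤ) (c : Fin n → k) (v : FreeMod k n r) :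
    proj k n f m (linForm c • v) = linForm c • proj k n f (m - 1) v := by
  have hv := mem_span_range_mon v
  induction hv using Submodule.span_induction with
  | mem v hv =>
    obtain ⟨u, rfl⟩ := hv
    rw [proj_of_mem_piece (linForm_smul_mem_piece c (mon_mem_piece f u)), proj_mon]
    by_cases h : monDegree f u = m - 1
    · rw [if_pos (by omega), if_pos h]
    · rw [if_neg (by omega), if_neg h, smul_zero]
  | zero => simp
  | add v w _ _ hv hw => rw [smul_add, map_add, hv, hw, map_add, smul_add]
  | smul a v _ hv => rw [smul_comm, map_smul, hv, map_smul, smul_comm]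

/-- Multiplication by `linForm c`, as a linear function of `c`. -/
noncomputable def linMul (k : Type*) [Field k] (n r : ℕ) :
    (Fin n → k) →ₗ[k] Module.End k (FreeMod k n r) where
  toFun c := Algebra.lsmul k k (FreeMod k n r) (linForm c)
  map_add' c c' := by
    rw [← map_add]
    congr 1
    simp [linForm, add_mul, Finset.sum_add_distrib]
  map_smul' a c := by
    rw [RingHom.id_apply, ← map_smul]
    congr 1
    simp [linForm, Finset.smul_sum, MvPolynomial.smul_eq_C_mul, mul_assoc]

theorem linMul_apply (c : Fin n → k) (v : FreeMod k n r) : linMul k n r c v = linForm c • v := rfl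

theorem linForm_single (i : Fin n) :
    linForm (Pi.single i (1 : k)) = (MvPolynomial.X i : Poly k n) := by
  rw [linForm, Finset.sum_eq_single i]
  · simp
  · intro j _ hj
    simp [hj]
  · simp

theorem isFreeLike (f : Fin r → ℤ) {m₀ : ℤ} (hm₀ : ∀ i, m₀ ≤ f i) :
    IsFreeLike (linMul k n r) (piece k n f) f m₀ where
  comm w w' v := by simp only [linMul_apply]; rw [smul_comm]
  family := ⟨fun _ => le_rfl, fun m w v hv => linForm_smul_mem_piece w hv⟩
  finite m := inferInstance
  eq_bot m hm := by
    rw [← Submodule.finrank_eq_zero (R := k), finrank_piece]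
    exact Finset.sum_eq_zero fun i _ => polyDim_of_neg (by have := hm₀ i; omega)
  finrank_le m P hP h := by
    classical
    set A := (moduleMonomials n f m).filter fun u => u.2 = 0 with hA
    have hle : piece k n f m ≤ P ⊔ Submodule.span k (mon k '' (A : Set (Fin r × (Fin n →₀ ℕ)))) := by
      rw [piece_eq_span, Submodule.span_le]
      rintro _ ⟨u, hu, rfl⟩
      by_cases hu0 : u.2 = 0
      · exact Submodule.mem_sup_right (Submodule.subset_span
          ⟨u, Finset.mem_coe.mpr (Finset.mem_filter.mpr ⟨hu, hu0⟩), rfl⟩)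
      · refine Submodule.mem_sup_left ?_
        obtain ⟨i, hi⟩ := Finsupp.ne_iff.mp hu0
        have hadd : u.2 - Finsupp.single i 1 + Finsupp.single i 1 = u.2 :=
          tsub_add_cancel_of_le (by rw [Finsupp.single_le_iff]; exact Nat.one_le_iff_ne_zero.mpr hi)
        have hd := monDegree_add_single f (u.1, u.2 - Finsupp.single i 1) i
        simp only [hadd] at hd
        have := h (Pi.single i 1) (mon k (u.1, u.2 - Finsupp.single i 1)) (by
          rw [← mem_moduleMonomials.mp hu, show monDegree f u = monDegree f (u.1, u.2) from rfl, hd,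
            add_sub_cancel_right]
          exact mon_mem_piece f _)
        rw [linMul_apply, linForm_single, X_smul_mon] at this
        simpa only [hadd] using this
    -- The generators of degree `m` are the monomials of degree `m` in zero variables.
    have hcard : A.card ≤ totalDim 0 f m := by
      rw [← card_moduleMonomials]
      refine Finset.card_le_card_of_injOn (fun u => (u.1, 0)) ?_ ?_
      · intro u hu
        obtain ⟨hu, hu0⟩ := Finset.mem_filter.mp hu
        rw [mem_moduleMonomials, monDegree, hu0] at hu
        rw [Finset.mem_coe, mem_moduleMonomials, monDegree]
        simpa using hu
      · intro u hu v hv huv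
        exact Prod.ext (Prod.ext_iff.mp huv).1
          ((Finset.mem_filter.mp hu).2.trans (Finset.mem_filter.mp hv).2.symm)
    have : FiniteDimensional k P := Submodule.finiteDimensional_of_le hP
    have h1 := Submodule.finrank_mono hle
    have h2 := Submodule.finrank_add_le_finrank_add_finrank P
      (Submodule.span k (mon k '' (A : Set (Fin r × (Fin n →₀ ℕ)))))
    rw [finrank_span_mon] at h2
    omega

/-! ### Graded submodules -/

section Graded

variable {f : Fin r → ℤ} {M : Submodule (Poly k n) (FreeMod k n r)}

theorem isFamily_subPiece (f : Fin r → ℤ) (M : Submodule (Poly k n) (FreeMod k n r)) :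
    IsFamily (linMul k n r) (piece k n f) (subPiece f M) where
  le _ := inf_le_right
  map_mem _ w _ hv := ⟨M.smul_mem _ hv.1, linForm_smul_mem_piece w hv.2⟩

theorem hilbQuot_eq_codim (f : Fin r → ℤ) (M : Submodule (Poly k n) (FreeMod k n r)) (m : ℤ) :
    hilbQuot f M m = codim (piece k n f) (subPiece f M) m := by
  have h := finrank_map_add_finrank_inf_ker (M.mkQ.restrictScalars k) (piece k n f m)
  have hk : LinearMap.ker (M.mkQ.restrictScalars k) = M.restrictScalars k := by
    ext v
    simp
  rw [hk, inf_comm] at h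
  rw [hilbQuot, codim, subPiece]
  omega

theorem IsGraded.proj_mem (hM : IsGraded f M) (m : ℤ) {v : FreeMod k n r} (hv : v ∈ M) :
    proj k n f m v ∈ M := by
  have hv' : v ∈ ⨆ m, subPiece f M m := by
    rw [hM]
    exact hv
  refine Submodule.iSup_induction _ (motive := fun v => proj k n f m v ∈ M) hv' ?_ (by simp) ?_
  · intro i v hv
    rw [proj_of_mem_piece hv.2]
    split_ifs
    · exact hv.1
    · exact zero_mem _
  · intro v w hv hw
    rw [map_add]
    exact add_mem hv hw

theorem mem_addForm {l : Poly k n} {v : FreeMod k n r} :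
    v ∈ addForm M l ↔ ∃ x ∈ M, ∃ y, x + l • y = v := by
  rw [addForm, Submodule.ideal_span_singleton_smul, Submodule.mem_sup]
  refine exists_congr fun x => and_congr_right fun _ => ⟨?_, ?_⟩
  · rintro ⟨_, hz, rfl⟩
    obtain ⟨y, -, rfl⟩ := Submodule.mem_smul_pointwise_iff_exists _ _ _ |>.mp hz
    exact ⟨y, rfl⟩
  · rintro ⟨y, rfl⟩
    exact ⟨l • y, Submodule.smul_mem_pointwise_smul _ _ _ Submodule.mem_top, rfl⟩

/-- Projecting `x + ℓy` to degree `m` gives `x_m + ℓy_{m-1}`, and `x_m` stays in `M` because `M` is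
graded. -/
theorem subPiece_addForm (hM : IsGraded f M) (c : Fin n → k) (m : ℤ) :
    subPiece f (addForm M (linForm c)) m
      = addMap (linMul k n r) (piece k n f) (subPiece f M) c m := by
  refine le_antisymm ?_ (sup_le ?_ ?_)
  · rintro v ⟨hv, hvm⟩
    obtain ⟨x, hx, y, rfl⟩ := mem_addForm.mp hv
    have h := proj_of_mem_piece (m := m) hvm
    rw [if_pos rfl, map_add, proj_linForm_smul] at h
    rw [← h]
    exact Submodule.add_mem_sup ⟨hM.proj_mem m hx, proj_mem_piece f m x⟩
      ⟨_, proj_mem_piece f (m - 1) y, rfl⟩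
  · rintro v ⟨hv, hvm⟩
    exact ⟨mem_addForm.mpr ⟨v, hv, 0, by simp⟩, hvm⟩
  · rintro _ ⟨y, hy, rfl⟩
    have := linForm_smul_mem_piece c hy
    rw [sub_add_cancel] at this
    exact ⟨mem_addForm.mpr ⟨0, M.zero_mem, y, by rw [zero_add, linMul_apply]⟩, this⟩

theorem hilbQuot_addForm (hM : IsGraded f M) (c : Fin n → k) (m : ℤ) :
    hilbQuot f (addForm M (linForm c)) m
      = codim (piece k n f) (addMap (linMul k n r) (piece k n f) (subPiece f M) c) m := by
  rw [hilbQuot_eq_codim, codim, codim, subPiece_addForm hM]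

theorem exists_forall_le_degree (f : Fin r → ℤ) : ∃ m₀, ∀ i, m₀ ≤ f i := by
  obtain ⟨m₀, h⟩ := (Set.finite_range f).bddBelow
  exact ⟨m₀, fun i => h ⟨i, rfl⟩⟩

/-- The restriction theorem in each degree separately. -/
theorem generic_hilbQuot_addForm_le [Infinite k] (hf : Monotone f) (hM : IsGraded f M) (m : ℤ) :
    Generic fun c => hilbQuot f (addForm M (linForm c)) m
      ≤ moduleLower n f m (hilbQuot f M m) := by
  obtain ⟨m₀, hm₀⟩ := exists_forall_le_degree f
  simp only [hilbQuot_addForm hM, hilbQuot_eq_codim f M]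
  exact generic_codim_addMap_le_moduleLower hf (isFreeLike f hm₀) n ((m - m₀).toNat + 1)
    (isFamily_subPiece f M) (Nat.le_add_left _ _) (by push_cast; omega)

end Graded

end Monomials

end GreenModule

namespace GreenModule

open Module
open scoped Pointwise

section Lex

variable {k : Type*} [Field k] {n r : ℕ} {f : Fin r → ℤ} {m : ℤ}

/-! ### Lex-segments -/

/-- A key for the order of the monomials of the free module. -/
def monKey (u : Fin r × (Fin n →₀ ℕ)) : Lex ((Fin r)ᵒᵈ × Lex (Fin n →₀ ℕ)) :=
  toLex (OrderDual.toDual u.1, toLex u.2)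

theorem monGT_iff {u v : Fin r × (Fin n →₀ ℕ)} : MonGT u v ↔ monKey v < monKey u := by
  rw [monKey, monKey, Prod.Lex.toLex_lt_toLex, MonGT]
  simp only [OrderDual.toDual_lt_toDual, OrderDual.toDual_inj, eq_comm]

theorem exists_isLexSegment (f : Fin r → ℤ) (m : ℤ) {p : ℕ} (hp : p ≤ totalDim n f m) :
    ∃ A : Finset (Fin r × (Fin n →₀ ℕ)), IsLexSegment f m A ∧ A.card = p := by
  classical
  induction p with
  | zero => exact ⟨∅, ⟨by simp, by simp⟩, rfl⟩
  | succ p ih =>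
    obtain ⟨A, hA, rfl⟩ := ih (by omega)
    have hne : (moduleMonomials n f m \ A).Nonempty := by
      rw [← Finset.card_pos]
      have := Finset.le_card_sdiff A (moduleMonomials n f m)
      rw [card_moduleMonomials] at this
      omega
    obtain ⟨u, hu, hmax⟩ := Finset.exists_max_image _ monKey hne
    obtain ⟨hu, huA⟩ := Finset.mem_sdiff.mp hu
    refine ⟨insert u A, ⟨?_, ?_⟩, Finset.card_insert_of_notMem huA⟩
    · intro v hv
      rcases Finset.mem_insert.mp hv with rfl | hv
      · exact mem_moduleMonomials.mp hu
      · exact hA.1 v hv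
    · intro v hv w hw hwv
      refine Finset.mem_insert_of_mem ?_
      rcases Finset.mem_insert.mp hv with rfl | hv
      · by_contra hwA
        have := hmax w (Finset.mem_sdiff.mpr ⟨mem_moduleMonomials.mpr hw, hwA⟩)
        exact absurd (monGT_iff.mp hwv) (not_lt.mpr this)
      · exact hA.2 v hv w hw hwv

theorem monomial_smul_mon (a : Fin n →₀ ℕ) (u : Fin r × (Fin n →₀ ℕ)) :
    (MvPolynomial.monomial a 1 : Poly k n) • mon k u = mon k (u.1, a + u.2) := by
  rw [mon, mon, ← Pi.single_smul, smul_eq_mul, MvPolynomial.monomial_mul, one_mul]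

/-- The span of a set of monomials of degree `m` is graded, and the given monomials span its component
of degree `m`. -/
theorem isGraded_span_mon {A : Finset (Fin r × (Fin n →₀ ℕ))} (hA : ∀ u ∈ A, monDegree f u = m) :
    IsGraded f (Submodule.span (Poly k n) (mon k '' (A : Set (Fin r × (Fin n →₀ ℕ))))) ∧
    subPiece f (Submodule.span (Poly k n) (mon k '' (A : Set (Fin r × (Fin n →₀ ℕ))))) m
      = Submodule.span k (mon k '' (A : Set (Fin r × (Fin n →₀ ℕ)))) := by
  set L := Submodule.span (Poly k n) (mon k '' (A : Set (Fin r × (Fin n →₀ ℕ)))) with hL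
  have hspan : Submodule.span k (Set.range (fun a : Fin n →₀ ℕ =>
      (MvPolynomial.monomial a 1 : Poly k n)) • (mon k '' (A : Set (Fin r × (Fin n →₀ ℕ)))))
        = L.restrictScalars k := by
    refine Submodule.span_smul_of_span_eq_top ?_ _
    have := (MvPolynomial.basisMonomials (Fin n) k).span_eq
    rwa [MvPolynomial.coe_basisMonomials] at this
  have hdeg : ∀ (a : Fin n →₀ ℕ) (u : Fin r × (Fin n →₀ ℕ)),
      monDegree f (u.1, a + u.2) = a.degree + monDegree f u := fun a u => by
    rw [monDegree, monDegree, map_add]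
    push_cast
    ring
  refine ⟨le_antisymm (iSup_le fun _ => inf_le_left) ?_, le_antisymm ?_ ?_⟩
  · rw [← hspan, Submodule.span_le]
    rintro _ ⟨_, ⟨a, rfl⟩, _, ⟨u, hu, rfl⟩, rfl⟩
    refine Submodule.mem_iSup_of_mem (monDegree f (u.1, a + u.2)) ⟨?_, ?_⟩
    · exact L.smul_mem _ (Submodule.subset_span ⟨u, hu, rfl⟩)
    · simp only [monomial_smul_mon]
      exact mon_mem_piece f _
  · rintro v ⟨hv, hvm⟩
    have h := proj_of_mem_piece (m := m) hvm
    rw [if_pos rfl] at h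
    rw [← h]
    rw [← hspan] at hv
    clear h hvm
    induction hv using Submodule.span_induction with
    | mem v hv =>
      obtain ⟨_, ⟨a, rfl⟩, _, ⟨u, hu, rfl⟩, rfl⟩ := hv
      simp only [monomial_smul_mon]
      rw [proj_mon, hdeg, hA u hu]
      split_ifs with h0
      · have : a = 0 := Finsupp.degree_eq_zero_iff a |>.mp (by omega)
        rw [this, zero_add]
        exact Submodule.subset_span ⟨u, hu, rfl⟩
      · exact zero_mem _
    | zero => simp
    | add v w _ _ hv hw => rw [map_add]; exact add_mem hv hw
    | smul c v _ hv => rw [map_smul]; exact Submodule.smul_mem _ _ hv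
  · rw [Submodule.span_le]
    rintro _ ⟨u, hu, rfl⟩
    refine ⟨Submodule.subset_span ⟨u, hu, rfl⟩, ?_⟩
    rw [← hA u hu]
    exact mon_mem_piece f u

theorem exists_isLexInDegree (k : Type*) [Field k] (f : Fin r → ℤ) (m : ℤ) {p : ℕ}
    (hp : p ≤ totalDim n f m) :
    ∃ L : Submodule (Poly k n) (FreeMod k n r), IsLexInDegree f L m p := by
  obtain ⟨A, hA, hAp⟩ := exists_isLexSegment f m hp
  obtain ⟨h1, h2⟩ := isGraded_span_mon (k := k) hA.1
  exact ⟨_, h1, A, hA, hAp, h2⟩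

theorem hilb_le_totalDim (f : Fin r → ℤ) (M : Submodule (Poly k n) (FreeMod k n r)) (m : ℤ) :
    hilb f M m ≤ totalDim n f m := by
  rw [← finrank_piece (k := k)]
  exact Submodule.finrank_mono inf_le_right

theorem hilbQuot_eq_sub (f : Fin r → ℤ) (M : Submodule (Poly k n) (FreeMod k n r)) (m : ℤ) :
    hilbQuot f M m = totalDim n f m - hilb f M m := by
  rw [hilbQuot_eq_codim, codim, finrank_piece, hilb]

theorem IsLexInDegree.hilb_eq {L : Submodule (Poly k n) (FreeMod k n r)} {p : ℕ}
    (hL : IsLexInDegree f L m p) : hilb f L m = p := by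
  obtain ⟨-, A, -, hA, h⟩ := hL
  rw [hilb, h, ← hA]
  exact finrank_span_mon A

/-- The dimension of `(F/L)_ℓ` in degree `m` for a lex-segment `L_m`, if the last variable occurs
in `ℓ`. -/
theorem IsLexInDegree.hilbQuot_addForm {L : Submodule (Poly k (n + 1)) (FreeMod k (n + 1) r)} {p : ℕ}
    (hL : IsLexInDegree f L m p) {c : Fin (n + 1) → k} (hc : c (Fin.last n) ≠ 0) :
    hilbQuot f (addForm L (linForm c)) m = moduleLower (n + 1) f m (hilbQuot f L m) := by
  classical
  obtain ⟨hgr, A, hA, hAp, hLA⟩ := id hL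
  change subPiece f L m = Submodule.span k (mon k '' (A : Set (Fin r × (Fin (n + 1) →₀ ℕ)))) at hLA
  set e : Fin (n + 1) → Fin (n + 1) →₀ ℕ := fun i => Finsupp.single i 1 with he
  set T := moduleMonomials (n + 1) f m with hT
  have hAT : A ⊆ T := fun u hu => mem_moduleMonomials.mpr (hA.1 u hu)
  -- `B₀` will represent a basis of `F_m/W`: the two bounds below give `dim W = |A| + |B₁|`.
  set B₀ := (T \ A).filter fun u => u.2 (Fin.last n) = 0 with hB₀
  set B₁ := (T \ A).filter fun u => ¬ u.2 (Fin.last n) = 0 with hB₁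
  have hcardB : B₀.card + B₁.card = (T \ A).card := Finset.card_filter_add_card_filter_not _
  have hcardT : (T \ A).card + A.card = T.card := Finset.card_sdiff_add_card_eq_card hAT
  have hcount : B₀.card = moduleLower (n + 1) f m (T \ A).card := by
    refine card_filter_last_eq_moduleLower (fun u hu => mem_moduleMonomials.mp
      (Finset.mem_sdiff.mp hu).1) fun u hu v hv huv => ?_
    refine Finset.mem_sdiff.mpr ⟨mem_moduleMonomials.mpr hv, fun hvA => ?_⟩
    exact (Finset.mem_sdiff.mp hu).2 (hA.2 v hvA u (mem_moduleMonomials.mp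
      (Finset.mem_sdiff.mp hu).1) huv)
  have hquot : hilbQuot f L m = (T \ A).card := by
    rw [hilbQuot_eq_sub, hL.hilb_eq, ← hAp, ← card_moduleMonomials, ← hT]
    omega
  rw [GreenModule.hilbQuot_addForm hgr, codim, addMap, finrank_piece, hquot, ← hcount,
    ← card_moduleMonomials, ← hT]
  set W := subPiece f L m ⊔ (piece k (n + 1) f (m - 1)).map (linMul k (n + 1) r c) with hW
  have hfinW : FiniteDimensional k W := by
    rw [hW, hLA]
    infer_instance
  -- the upper bound for the dimension
  have hsub : ∀ u : Fin r × (Fin (n + 1) →₀ ℕ), ¬ u.2 (Fin.last n) = 0 →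
      u.2 - e (Fin.last n) + e (Fin.last n) = u.2 := fun u hu =>
    tsub_add_cancel_of_le (by rw [Finsupp.single_le_iff]; exact Nat.one_le_iff_ne_zero.mpr hu)
  have hup : W ≤ Submodule.span k (mon k '' (A : Set (Fin r × (Fin (n + 1) →₀ ℕ)))) ⊔
      Submodule.span k ((fun u : Fin r × (Fin (n + 1) →₀ ℕ) =>
        linForm c • mon k (u.1, u.2 - e (Fin.last n))) ''
          (B₁ : Set (Fin r × (Fin (n + 1) →₀ ℕ)))) := by
    refine sup_le (hLA.le.trans le_sup_left) ?_
    rw [piece_eq_span, Submodule.map_span, Submodule.span_le]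
    rintro _ ⟨_, ⟨v, hv, rfl⟩, rfl⟩
    have hv' : monDegree f v = m - 1 := mem_moduleMonomials.mp hv
    have hdeg : ∀ i, monDegree f (v.1, v.2 + e i) = m := fun i => by
      rw [he, monDegree_add_single, hv', sub_add_cancel]
    -- The last variable is the smallest. If its product with `v` lies in the segment, so do the
    -- products with all other variables, and `ℓv` lies in `L_m`. Otherwise this product is an
    -- element of `B₁`.
    by_cases hvA : (v.1, v.2 + e (Fin.last n)) ∈ A
    · refine Submodule.mem_sup_left ?_
      rw [linMul_apply, linForm_smul_mon]
      refine sum_mem fun i _ => Submodule.smul_mem _ _ (Submodule.subset_span ⟨_, ?_, rfl⟩)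
      rcases (Fin.le_last i).eq_or_lt with rfl | hi
      · exact hvA
      · refine hA.2 _ hvA _ (hdeg i) (Or.inr ⟨rfl, ?_⟩)
        simp only [toLex_add]
        exact add_lt_add_right (Finsupp.Lex.single_lt_iff.mpr hi) _
    · refine Submodule.mem_sup_right (Submodule.subset_span ⟨(v.1, v.2 + e (Fin.last n)), ?_, ?_⟩)
      · refine Finset.mem_coe.mpr (Finset.mem_filter.mpr ⟨Finset.mem_sdiff.mpr
          ⟨mem_moduleMonomials.mpr (hdeg _), hvA⟩, ?_⟩)
        simp [he]
      · simp only [add_tsub_cancel_right]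
        rfl
  have h1 := (Submodule.finrank_mono hup).trans
    (Submodule.finrank_add_le_finrank_add_finrank _ _)
  rw [finrank_span_mon] at h1
  have h2 := finrank_span_image_le (k := k) B₁ fun u : Fin r × (Fin (n + 1) →₀ ℕ) =>
        linForm c • mon k (u.1, u.2 - e (Fin.last n))
  -- the lower bound for the dimension
  have hlow : piece k (n + 1) f m
      ≤ W ⊔ Submodule.span k (mon k '' (B₀ : Set (Fin r × (Fin (n + 1) →₀ ℕ)))) := by
    rw [piece_eq_span, Submodule.span_le]
    -- Induction on the exponent of the last variable. If it divides `u`, let `v` be the quotient: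
    -- `ℓv` lies in `W`, its terms other than `u` have smaller exponent, and the coefficient of `u`
    -- is nonzero.
    suffices h : ∀ (t : ℕ) (u : Fin r × (Fin (n + 1) →₀ ℕ)), monDegree f u = m →
        u.2 (Fin.last n) = t → mon k u ∈
          W ⊔ Submodule.span k (mon k '' (B₀ : Set (Fin r × (Fin (n + 1) →₀ ℕ)))) by
      rintro _ ⟨u, hu, rfl⟩
      exact h _ u (mem_moduleMonomials.mp hu) rfl
    intro t
    induction t with
    | zero =>
      intro u hu hut
      by_cases huA : u ∈ A
      · exact Submodule.mem_sup_left (Submodule.mem_sup_left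
          (hLA ▸ Submodule.subset_span ⟨u, huA, rfl⟩))
      · exact Submodule.mem_sup_right (Submodule.subset_span ⟨u, Finset.mem_coe.mpr
          (Finset.mem_filter.mpr ⟨Finset.mem_sdiff.mpr ⟨mem_moduleMonomials.mpr hu, huA⟩, hut⟩),
          rfl⟩)
    | succ t ih =>
      intro u hu hut
      have hadd := hsub u (by omega)
      set v : Fin r × (Fin (n + 1) →₀ ℕ) := (u.1, u.2 - e (Fin.last n)) with hv
      have huv : (v.1, v.2 + e (Fin.last n)) = u := Prod.ext rfl hadd
      have hvdeg : monDegree f v = m - 1 := by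
        have := monDegree_add_single f v (Fin.last n)
        rw [show (v.1, v.2 + Finsupp.single (Fin.last n) 1) = u from huv, hu] at this
        omega
      have hmem : linForm c • mon k v ∈
          W ⊔ Submodule.span k (mon k '' (B₀ : Set (Fin r × (Fin (n + 1) →₀ ℕ)))) :=
        Submodule.mem_sup_left (Submodule.mem_sup_right
          ⟨mon k v, hvdeg ▸ mon_mem_piece f v, rfl⟩)
      rw [linForm_smul_mon, Fin.sum_univ_castSucc] at hmem
      have hrest : ∑ i : Fin n, c i.castSucc • mon k (v.1, v.2 + Finsupp.single i.castSucc 1) ∈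
          W ⊔ Submodule.span k (mon k '' (B₀ : Set (Fin r × (Fin (n + 1) →₀ ℕ)))) := by
        refine sum_mem fun i _ => Submodule.smul_mem _ _ (ih _ ?_ ?_)
        · rw [monDegree_add_single, hvdeg, sub_add_cancel]
        · simp only [Finsupp.add_apply, hv, Finsupp.tsub_apply, he, Finsupp.single_eq_same, hut]
          rw [Finsupp.single_eq_of_ne (Fin.castSucc_lt_last i).ne']
          omega
      have := (Submodule.add_mem_iff_right _ hrest).mp hmem
      rw [show (v.1, v.2 + Finsupp.single (Fin.last n) 1) = u from huv] at this
      exact (Submodule.smul_mem_iff _ hc).mp this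
  have h3 := (Submodule.finrank_mono hlow).trans
    (Submodule.finrank_add_le_finrank_add_finrank _ _)
  rw [finrank_span_mon, finrank_piece, ← card_moduleMonomials, ← hT] at h3
  omega

/-- The only condition on the form is that its last coefficient is nonzero. It involves neither `m`
nor `L`, so both may be quantified inside. -/
theorem generic_isLexInDegree (hf : Monotone f) : Generic fun c : Fin n → k =>
    ∀ (m : ℤ) (L : Submodule (Poly k n) (FreeMod k n r)) (p : ℕ), IsLexInDegree f L m p →
      hilbQuot f (addForm L (linForm c)) m = moduleLower n f m (hilbQuot f L m) := by
  cases n with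
  | zero =>
    refine .of_forall fun c m L p _ => ?_
    have h0 : linForm c = 0 := by simp [linForm]
    rw [moduleLower_of_le 0 hf m (by rw [hilbQuot_eq_sub]; exact Nat.sub_le _ _), h0, addForm]
    simp
  | succ n =>
    refine (generic_apply_ne_zero (φ := LinearMap.proj (Fin.last n)) fun h => ?_).mono
      fun c hc m L p hL => hL.hilbQuot_addForm hc
    have := LinearMap.congr_fun h (Pi.single (Fin.last n) 1)
    simp at this

end Lex

end GreenModule

namespace GreenModule

open Module MvPolynomial
open scoped Pointwise

section Uniform

variable {k : Type*} [Field k] {n r : ℕ}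

/-! ### Torsion with respect to the irrelevant ideal -/

section Torsion

variable (Q : Type*) [AddCommGroup Q] [Module (Poly k n) Q] [Module.Finite (Poly k n) Q]

/-- The submodules killed by growing powers of the irrelevant ideal increase, hence stabilize in a
Noetherian module. -/
theorem exists_torsionBySet_saturated : ∃ N : ℕ, ∀ q : Q,
    (∀ p ∈ idealOfVars (Fin n) k, p • q ∈ Submodule.torsionBySet (Poly k n) Q
      (idealOfVars (Fin n) k ^ N : Ideal (Poly k n))) →
    q ∈ Submodule.torsionBySet (Poly k n) Q (idealOfVars (Fin n) k ^ N : Ideal (Poly k n)) := by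
  let F : ℕ →o Submodule (Poly k n) Q :=
    { toFun := fun N => Submodule.torsionBySet (Poly k n) Q
        (idealOfVars (Fin n) k ^ N : Ideal (Poly k n))
      monotone' := fun a b hab =>
        Submodule.torsionBySet_le_torsionBySet_of_subset (Ideal.pow_le_pow_right hab) }
  obtain ⟨N, hN⟩ := monotone_stabilizes_iff_noetherian.mpr
    (inferInstance : IsNoetherian (Poly k n) Q) F
  refine ⟨N, fun q hq => ?_⟩
  change q ∈ F N
  rw [hN (N + 1) (Nat.le_succ N)]
  change q ∈ Submodule.torsionBySet (Poly k n) Q _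
  rw [Submodule.mem_torsionBySet_iff]
  rintro ⟨p, hp⟩
  simp only
  rw [SetLike.mem_coe, pow_succ] at hp
  refine Submodule.mul_induction_on hp (fun a ha b hb => ?_) fun x y hx hy => ?_
  · rw [mul_smul]
    exact (Submodule.mem_torsionBySet_iff _ _).mp (hq b hb) ⟨a, ha⟩
  · rw [add_smul, hx, hy, add_zero]

/-- Monomials of degree at least `N` kill the torsion, so finitely many generators times the
monomials of degree at most `N` span it over `k`. -/
theorem finiteDimensional_torsionBySet [Module k Q] [IsScalarTower k (Poly k n) Q] (N : ℕ) :
    FiniteDimensional k ((Submodule.torsionBySet (Poly k n) Q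
      (idealOfVars (Fin n) k ^ N : Ideal (Poly k n))).restrictScalars k) := by
  set T := Submodule.torsionBySet (Poly k n) Q
    (idealOfVars (Fin n) k ^ N : Ideal (Poly k n)) with hT
  obtain ⟨t, ht⟩ := (IsNoetherian.noetherian T : T.FG)
  have hspan : Submodule.span k (Set.range (fun a : Fin n →₀ ℕ => (monomial a 1 : Poly k n)) •
      (t : Set Q)) = T.restrictScalars k := by
    rw [← ht]
    refine Submodule.span_smul_of_span_eq_top ?_ _
    have := (basisMonomials (Fin n) k).span_eq
    rwa [coe_basisMonomials] at this
  have hfin : (((fun a : Fin n →₀ ℕ => (monomial a 1 : Poly k n)) '' {a | a.degree ≤ N}) •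
      (t : Set Q)).Finite := ((Finsupp.finite_of_degree_le N).image _).smul t.finite_toSet
  have := FiniteDimensional.span_of_finite k hfin
  suffices h : T.restrictScalars k ≤ Submodule.span k (((fun a : Fin n →₀ ℕ =>
      (monomial a 1 : Poly k n)) '' {a | a.degree ≤ N}) • (t : Set Q)) from
    Submodule.finiteDimensional_of_le h
  refine hspan.ge.trans (Submodule.span_le.mpr ?_)
  rintro _ ⟨_, ⟨a, rfl⟩, q, hq, rfl⟩
  by_cases ha : a.degree ≤ N
  · exact Submodule.subset_span ⟨_, ⟨a, ha, rfl⟩, q, hq, rfl⟩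
  · have hqT : q ∈ T := ht ▸ Submodule.subset_span hq
    have h0 := (Submodule.mem_torsionBySet_iff _ _).mp hqT ⟨monomial a 1,
      (monomial_mem_pow_idealOfVars_iff N a one_ne_zero).mpr (not_le.mp ha).le⟩
    simp only at h0 ⊢
    rw [h0]
    exact zero_mem _

/-- A generic linear form is a nonzerodivisor modulo the torsion. -/
theorem generic_mem_torsion {T : Submodule (Poly k n) Q}
    (hT : ∀ q : Q, (∀ p ∈ idealOfVars (Fin n) k, p • q ∈ T) → q ∈ T) :
    Generic fun c : Fin n → k => ∀ q : Q, linForm c • q = 0 → q ∈ T := by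
  have hP : Generic fun c : Fin n → k => ∀ P ∈ associatedPrimes (Poly k n) (Q ⧸ T),
      linForm c ∉ P := by
    refine Generic.forall_mem_finite (associatedPrimes.finite _ _) fun P hP => ?_
    obtain ⟨hprime, x, hx⟩ := isAssociatedPrime_iff.mp hP
    let V : Submodule k (Fin n → k) :=
      { carrier := {c | linForm c ∈ P}
        zero_mem' := by simp [linForm]
        add_mem' := fun {c c'} hc hc' => by
          rw [Set.mem_ofPred_eq, show linForm (c + c') = (linForm c + linForm c' : Poly k n) by
            simp [linForm, add_mul, Finset.sum_add_distrib]]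
          exact P.add_mem hc hc'
        smul_mem' := fun a c hc => by
          rw [Set.mem_ofPred_eq, show linForm (a • c) = (C a * linForm c : Poly k n) by
            simp [linForm, Finset.mul_sum, mul_assoc]]
          exact P.mul_mem_left _ hc }
    -- The forms in an associated prime `P` of `Q/T` are a proper subspace. Otherwise `P`, the
    -- annihilator of the class of some `q`, contains the irrelevant ideal, and saturation puts `q`
    -- in `T`.
    refine generic_notMem (V := V) fun hV => ?_
    obtain ⟨q, rfl⟩ := T.mkQ_surjective x
    have hmem : ∀ p, p ∈ P ↔ p • q ∈ T := fun p => by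
      rw [hx, Submodule.mem_colon_singleton, Submodule.mem_bot, ← map_smul, Submodule.mkQ_apply,
        Submodule.Quotient.mk_eq_zero]
    have hle : idealOfVars (Fin n) k ≤ P := by
      rw [Ideal.span_le]
      rintro _ ⟨i, rfl⟩
      have : Pi.single i (1 : k) ∈ V := hV ▸ Submodule.mem_top
      rw [SetLike.mem_coe, ← linForm_single]
      exact this
    have hq := hT q fun p hp => (hmem p).mp (hle hp)
    exact hprime.ne_top ((Ideal.eq_top_iff_one P).mpr ((hmem 1).mpr (by rwa [one_smul])))
  refine hP.mono fun c hc q hq => ?_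
  have hreg : IsSMulRegular (Q ⧸ T) (linForm c) := by
    by_contra hn
    have : linForm c ∈ ⋃ P ∈ associatedPrimes (Poly k n) (Q ⧸ T), (P : Set (Poly k n)) := by
      rw [biUnion_associatedPrimes_eq_compl_regular]
      exact hn
    obtain ⟨P, hP, hcP⟩ := Set.mem_iUnion₂.mp this
    exact hc P hP hcP
  have h0 : linForm c • T.mkQ q = linForm c • (0 : Q ⧸ T) := by
    rw [← map_smul, hq, map_zero, smul_zero]
  exact (Submodule.Quotient.mk_eq_zero T).mp (hreg h0)

end Torsion

/-! ### Uniformity in the degree -/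

variable {f : Fin r → ℤ} {M : Submodule (Poly k n) (FreeMod k n r)}

/-- Elements of different degrees outside of a graded submodule are independent modulo it. -/
theorem IsGraded.linearIndependent_mkQ (hM : IsGraded f M) {X : Set ℤ} {v : X → FreeMod k n r}
    (hv : ∀ m : X, v m ∈ piece k n f m) (hvM : ∀ m, v m ∉ M) :
    LinearIndependent k fun m => M.mkQ (v m) := by
  rw [linearIndependent_iff']
  intro s g hg m hm
  have hmem : ∑ m ∈ s, g m • v m ∈ M := by
    rw [← Submodule.Quotient.mk_eq_zero M, ← Submodule.mkQ_apply, map_sum, ← hg]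
    rfl
  have h1 := hM.proj_mem m hmem
  rw [map_sum, Finset.sum_eq_single m] at h1
  · rw [map_smul, proj_of_mem_piece (hv m), if_pos rfl] at h1
    by_contra hgm
    refine hvM m ?_
    have := M.smul_mem (C (g m)⁻¹) h1
    rwa [← algebraMap_eq, algebraMap_smul, smul_smul, inv_mul_cancel₀ hgm, one_smul] at this
  · intro m' _ hne
    rw [map_smul, proj_of_mem_piece (hv m'), if_neg fun h => hne (Subtype.ext h), smul_zero]
  · exact fun h => absurd hm h

/-- In almost all degrees, a generic linear form is a nonzerodivisor on `F/M`. -/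
theorem exists_finite_generic_mem (hM : IsGraded f M) : ∃ X : Set ℤ, X.Finite ∧
    Generic fun c : Fin n → k => ∀ m ∉ X, ∀ v ∈ piece k n f m, linForm c • v ∈ M → v ∈ M := by
  obtain ⟨N, hN⟩ := exists_torsionBySet_saturated (k := k) (n := n) (FreeMod k n r ⧸ M)
  have hfin := finiteDimensional_torsionBySet (k := k) (n := n) (FreeMod k n r ⧸ M) N
  set T := Submodule.torsionBySet (Poly k n) (FreeMod k n r ⧸ M)
    (idealOfVars (Fin n) k ^ N : Ideal (Poly k n)) with hT
  -- `X` consists of the degrees in which `F/M` has nonzero torsion. One torsion element from each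
  -- of them gives an independent family in a finite-dimensional space, so `X` is finite.
  refine ⟨{m | ∃ v ∈ piece k n f m, v ∉ M ∧ M.mkQ v ∈ T}, ?_, ?_⟩
  · have hex : ∀ m : {m | ∃ v ∈ piece k n f m, v ∉ M ∧ M.mkQ v ∈ T},
        ∃ v ∈ piece k n f m, v ∉ M ∧ M.mkQ v ∈ T := fun m => m.2
    choose v hv hvM hvT using hex
    have hli := hM.linearIndependent_mkQ hv hvM
    have hli' : LinearIndependent k fun m => (⟨M.mkQ (v m), hvT m⟩ : T.restrictScalars k) :=
      LinearIndependent.of_comp (T.restrictScalars k).subtype hli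
    have := hli'.finite_of_isNoetherian
    exact Set.toFinite _
  · refine (generic_mem_torsion (FreeMod k n r ⧸ M) hN).mono fun c hc m hm v hv hcv => ?_
    by_contra hvM
    refine hm ⟨v, hv, hvM, hc _ ?_⟩
    rw [← map_smul]
    exact (Submodule.Quotient.mk_eq_zero M).mpr hcv

/-- The restriction theorem in all degrees for one generic linear form. -/
theorem generic_forall_hilbQuot_addForm_le [Infinite k] (hf : Monotone f) (hM : IsGraded f M) :
    Generic fun c : Fin n → k => ∀ m, hilbQuot f (addForm M (linForm c)) m
      ≤ moduleLower n f m (hilbQuot f M m) := by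
  obtain ⟨m₀, hm₀⟩ := exists_forall_le_degree f
  obtain ⟨X, hX, hgen⟩ := exists_finite_generic_mem hM
  have hfin := Generic.forall_mem_finite (hX.image (· + 1)) fun m _ =>
    generic_hilbQuot_addForm_le hf hM m
  refine (hgen.and hfin).mono ?_
  rintro c ⟨hc, hcX⟩ m
  by_cases hm : m - 1 ∈ X
  · exact hcX m ⟨m - 1, hm, sub_add_cancel m 1⟩
  -- Off `X`, multiplication by the form is injective on `(F/M)_{m-1}`, so the dimension in degree
  -- `m` is the difference of two values of the Hilbert function, the same for `c` and `c'`. The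
  -- auxiliary `c'` may depend on `m`.
  · obtain ⟨c', hc', hle⟩ := (hgen.and (generic_hilbQuot_addForm_le hf hM m)).exists
    have hcolon : ∀ c : Fin n → k, (∀ m ∉ X, ∀ v ∈ piece k n f m, linForm c • v ∈ M → v ∈ M) →
        colon (linMul k n r) (piece k n f) (subPiece f M) c (m - 1) = subPiece f M (m - 1) :=
      fun c hc => le_antisymm (fun v hv => ⟨hc _ hm v hv.1 hv.2.1, hv.1⟩)
        fun v hv => ⟨hv.2, (isFamily_subPiece f M).map_mem _ c v hv⟩
    have h1 := codim_eq (isFreeLike f hm₀) (isFamily_subPiece f M) c m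
    have h2 := codim_eq (isFreeLike f hm₀) (isFamily_subPiece f M) c' m
    rw [codim, codim, hcolon c hc] at h1
    rw [codim, codim, hcolon c' hc'] at h2
    rw [hilbQuot_addForm hM] at hle ⊢
    omega

theorem Generic.forGenericForm [Infinite k] {P : Poly k n → Prop}
    (h : Generic fun c : Fin n → k => P (linForm c)) : ForGenericForm P := by
  obtain ⟨p, hp, h⟩ := h
  refine ⟨{c | eval c p ≠ 0}, Generic.exists (P := fun c => eval c p ≠ 0) ⟨p, hp, fun c hc => hc⟩,
    ⟨Ideal.span {p}, ?_⟩, fun c hc => h c hc⟩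
  ext c
  simp [zeroLocus_span, aeval_eq_eval]

end Uniform

end GreenModule

/-! ### The restriction theorem for graded submodules -/

theorem mainTheorem1 {k : Type*} [Field k] [Infinite k] (n r : ℕ)
    (f : Fin r → ℤ) (hf : Monotone f)
    (M : Submodule (GreenModule.Poly k n) (GreenModule.FreeMod k n r))
    (hM : GreenModule.IsGraded f M) :
    (∀ m : ℤ, ∃ L : Submodule (GreenModule.Poly k n) (GreenModule.FreeMod k n r),
      GreenModule.IsLexInDegree f L m (GreenModule.hilb f M m)) ∧
    GreenModule.ForGenericForm (fun l : GreenModule.Poly k n =>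
      ∀ (m : ℤ) (L : Submodule (GreenModule.Poly k n) (GreenModule.FreeMod k n r)),
        GreenModule.IsLexInDegree f L m (GreenModule.hilb f M m) →
          GreenModule.hilbQuot f (GreenModule.addForm M l) m
              ≤ GreenModule.hilbQuot f (GreenModule.addForm L l) m ∧
          GreenModule.hilbQuot f (GreenModule.addForm L l) m
              = GreenModule.moduleLower n f m (GreenModule.hilbQuot f M m)) := by
  refine ⟨fun m => GreenModule.exists_isLexInDegree k f m (GreenModule.hilb_le_totalDim f M m),
    GreenModule.Generic.forGenericForm ?_⟩
  refine ((GreenModule.generic_forall_hilbQuot_addForm_le hf hM).and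
    (GreenModule.generic_isLexInDegree hf)).mono ?_
  rintro c ⟨hle, hlex⟩ m L hL
  have h1 := hlex m L _ hL
  have h2 : GreenModule.hilbQuot f L m = GreenModule.hilbQuot f M m := by
    rw [GreenModule.hilbQuot_eq_sub, GreenModule.hilbQuot_eq_sub, hL.hilb_eq]
  rw [h2] at h1
  exact ⟨h1 ▸ hle m, h1⟩
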